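/- **Setting.** Let $X$ be an open subset (a coordinate domain) of a finite-dimensional real vector space $E$ and let $T$ be a finite-dimensional Euclidean space with inner product $\eta$. All groups are local groups (pseudogroups): their elements are fields defined on open subsets of $X$, and a product is defined wherever the composition makes sense. The *gauge group of translations* $T^g$ consists of smooth displacement fields $\tilde t_x$ such that $x\mapsto x+\tilde t_x$ is injective with values in $X$ and $\det(1+\partial_x\tilde t_x)\ne 0$, with product $(\tilde t\times\tilde t')_x=\tilde t_x+\tilde t'_{x'}$, $x'=x+\tilde t_x$. $R^g$ denotes the group of smooth fields $r_x$ of linear isometries of $(T,\eta)$. The group $G^g=T^g\rtimes R^g$ of pairs has the product $(\tilde t_x+\tilde t'_{x'},\ \tilde r_x\tilde r'_{x'})$. *Deformations.* A deformation is a smooth family of diffeomorphisms $H_x$ from $X-x$ onto subsets of $T$, with $H_x(0)=0$; put $K_x=H_x^{-1}$, $f_x(t)=x+K_x(t)$, $\varphi_x(t,t')=H_x(K_x(t)+K_{f_x(t)}(t'))$, $k_x=\partial K_x(0)$, $h_x=k_x^{-1}$, $\lambda_x(t)=\partial_{t'}\varphi_x(t,0)$, $\gamma_x=\partial\lambda_x(0)$,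 $\Gamma_x=k_x\circ\partial^2H_x(0)$. The deformed group of translations is $T^g$ reparametrized by $t_x=H_x(\tilde t_x)$; it acts on $X$ by $x\mapsto f_x(t_x)$. The deformation is *canonical* if any two points $x,\bar x\in X$ are joined by a smooth curve $c:[0,1]\to X$ with $c(s)=f_x(s\tau_x)$ and $\varphi_x(s\tau_x,s'\tau_{c(s)})=(s+s')\tau_x$ for all $s,s+s'\in[0,1]$, where $\tau_{c(s)}=h_{c(s)}\langle\dot c(s)\rangle$. A *group of Riemannian translations* $RT$ is the deformed group of a canonical deformation $H$ such that $\eta\langle\tau_{c(s)},\tau_{c(s)}\rangle$ is constant along all these curves. *Parallel transports.* Let $RT$ be given by $H$. Let $\bar H$ be a deformation and $\pi_x(t)$ a smooth family of isometries of $(T,\eta)$ with $\pi_x(0)=1$, and let $G$ be $G^g$ reparametrized by pairs $\vartheta_x=(t_x,r_x)$ with $t_x=\bar H_x(\tilde t_x)$, $\tilde r_x=r_x\pi_x(t_x)$. Bars denote the objects built from $\bar H$. $G$ acts on $X$ by $x\mapsto x'=\bar f_x(t_x)$, and on $TX$ by taking a vector $v$ at $x'$ to the vector $\bar k_x r_x\pi_x(t_x)\bar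 h_{x'}v$ at $x$. $G$ is a *group of parallel transports* $DP$ over $RT$ if (consistency) $\bar k_x=k_x$ and $\partial\pi_x(0)=\bar\gamma_x=\gamma_x$, i.e. the infinitesimal $\pi$-transports and $\lambda$-transports coincide with those of $RT$, and (extended canonicity) any two points of $X$ are joined by a smooth curve as above (for $\bar H$) along which $((s\tau,1)\times(s'\tau,1))_x=((s+s')\tau_x,1)$. **Theorem 4.** Let $DP$ be a group of parallel transports over a group of Riemannian translations $RT$. Then: 1. $DP$ acts on $X$ as $RT$ does: $\bar f_x=f_x$ and $\bar\varphi_x=\varphi_x$ for all $x\in X$, and $(t,r)\mapsto t$ is a homomorphism of $DP$ onto $RT$ compatible with the actions on $X$. The kernel of inefficiency of the action (the set of elements acting on $X$ trivially on their domain) is $\{(0,r)\}$, a copy of $R^g$. 2. $DP$ defines a Riemannian structure on $X$: $g_x\langle v,w\rangle=\eta\langle\bar h_xv,\bar h_xw\rangle$ is a smooth Riemannian metric (the same as that of $RT$), the frame field $\bar k_x$ is orthonormal for it, and $\bar\Gamma$ is its Levi-Civita connection. 3. (Length principle.) Any $x,x'\in X$ satisfy $x'=\bar f_x(\tau)$ for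 some $\tau$. If $S\ge0$ and $S\tau$ is a parameter at $x$, so are all $s\tau$, $0\le s\le S$, and $s\mapsto\bar f_x(s\tau)$, $s\in[0,S]$, is (for $S>0$) a geodesic; its length is $S\|\tau\|$. If $n\tau$ is a parameter at $x$, then $m\le n$ steps of moving the scale $\tau$ along itself, $(x,\tau)\mapsto(\bar f_x(\tau),\pi_x(\tau)^{-1}\tau)$, lead to the point $\bar f_x(m\tau)$, preserve the length of the scale, and thus measure the length $m\|\tau\|$ of the geodesic segment; each step agrees with the transport in $RT$, $\lambda_x(\tau)\langle\pi_x(\tau)^{-1}\tau\rangle=\tau$. The length $\int_a^b\sqrt{g(\dot c,\dot c)}$ of an arbitrary $C^1$ curve $c:[a,b]\to X$ is the limit of $\sum_i\|\bar H_{c(t_i)}(c(t_{i+1})-c(t_i))\|$ as the mesh of the partition $a=t_0\le\dots\le t_n=b$ tends to $0$. 4. (Equality principle.) The formula above is an action of $DP$ in $TX$, and it preserves the lengths of vectors and the angles between them. Two families of vectors $(v_i)$ at $x'$ and $(w_i)$ at $x$ can be superimposed by an element of $DP$ that takes $x$ to $x'$ if and only if $g_{x'}\langle v_i,v_j\rangle=g_x\langle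 w_i,w_j\rangle$ for all $i,j$. 5. $DP$ contains $RT$ as a subgroup: $t\mapsto(t,\pi(t)^{-1})$ (the image of $T^g\subset G^g$) is an injective homomorphism $RT\to DP$ compatible with the actions on $X$. -/

import Mathlib

open scoped ContDiff Topology
open Set TopologicalSpace

namespace GaugeGeometry

noncomputable section

set_option linter.unusedSectionVars false

/-- Local (pseudo-)groups of transformations: the product is total because a product of two
local transformations may have a smaller (even empty) domain; `a * a⁻¹` is the identity on the
domain of `a`.  These are the usual axioms of an inverse monoid; the invertible elements are the
transformations that are globally defined, with a globally defined inverse. -/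
class PseudoGroup (G : Type*) extends Monoid G, Inv G where
  mul_inv_mul : ∀ a : G, a * a⁻¹ * a = a
  inv_inv : ∀ a : G, a⁻¹⁻¹ = a
  mul_inv_rev : ∀ a b : G, (a * b)⁻¹ = b⁻¹ * a⁻¹
  idem_comm : ∀ a b : G, (a * a⁻¹) * (b * b⁻¹) = (b * b⁻¹) * (a * a⁻¹)

/-- Transport of a pseudogroup structure along a bijection. -/
@[reducible] def PseudoGroup.transfer {G G' : Type*} [PseudoGroup G] (e : G ≃ G') :
    PseudoGroup G' where
  mul a b := e (e.symm a * e.symm b)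
  one := e 1
  inv a := e (e.symm a)⁻¹
  mul_assoc a b c := by
    change e (e.symm (e _) * _) = e (_ * e.symm (e _))
    simp [mul_assoc]
  one_mul a := by
    change e (e.symm (e 1) * _) = a
    simp
  mul_one a := by
    change e (_ * e.symm (e 1)) = a
    simp
  mul_inv_mul a := by
    change e (e.symm (e (_ * e.symm (e _))) * _) = a
    simp [PseudoGroup.mul_inv_mul]
  inv_inv a := by
    simp [PseudoGroup.inv_inv]
  mul_inv_rev a b := by
    change e (e.symm (e _))⁻¹ = e (e.symm (e _) * e.symm (e _))
    simp [PseudoGroup.mul_inv_rev]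
  idem_comm a b := by
    change e (e.symm (e (_ * e.symm (e _))) * e.symm (e (_ * e.symm (e _)))) =
      e (e.symm (e (_ * e.symm (e _))) * e.symm (e (_ * e.symm (e _))))
    simp [PseudoGroup.idem_comm]

variable {E : Type*} [NormedAddCommGroup E] [NormedSpace ℝ E] [FiniteDimensional ℝ E]
variable {T : Type*} [NormedAddCommGroup T] [InnerProductSpace ℝ T] [FiniteDimensional ℝ T]

/-! ### The gauge group of translations, as a local group -/

/-- An element of the gauge group of translations of the coordinate domain `X`: a smooth
displacement field `disp` on an open `dom ⊆ X` such that `x ↦ x + disp x` is injective,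
has values in `X`, and has nonvanishing Jacobian.  (Off `dom` the field is set to `0`, so
that two elements are equal iff they have the same domain and agree on it.) -/
@[ext] structure Trans (X : Opens E) where
  dom : Set E
  disp : E → E
  isOpen_dom : IsOpen dom
  dom_subset : dom ⊆ X
  smooth : ContDiffOn ℝ ∞ disp dom
  maps : ∀ x ∈ dom, x + disp x ∈ X
  inj : InjOn (fun x => x + disp x) dom
  det_ne : ∀ x ∈ dom, (ContinuousLinearMap.id ℝ E + fderiv ℝ disp x).det ≠ 0
  disp_off : ∀ x ∉ dom, disp x = 0

namespace Trans

variable {X : Opens E}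

/-- The transformation `x ↦ x + disp x`. -/
def act (a : Trans X) (x : E) : E := x + a.disp x

lemma contDiffAt_disp (a : Trans X) {x : E} (hx : x ∈ a.dom) : ContDiffAt ℝ ∞ a.disp x :=
  a.smooth.contDiffAt (a.isOpen_dom.mem_nhds hx)

lemma contDiffAt_act (a : Trans X) {x : E} (hx : x ∈ a.dom) : ContDiffAt ℝ ∞ a.act x :=
  contDiffAt_id.add (a.contDiffAt_disp hx)

lemma hasFDerivAt_act (a : Trans X) {x : E} (hx : x ∈ a.dom) :
    HasFDerivAt a.act (ContinuousLinearMap.id ℝ E + fderiv ℝ a.disp x) x :=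
  (hasFDerivAt_id x).add (((a.contDiffAt_disp hx).differentiableAt (by simp)).hasFDerivAt)

lemma continuousOn_act (a : Trans X) : ContinuousOn a.act a.dom := fun _ hx =>
  (a.contDiffAt_act hx).continuousAt.continuousWithinAt

/-- The invertible derivative of `act`. -/
def derivEquiv (a : Trans X) {x : E} (hx : x ∈ a.dom) : E ≃L[ℝ] E :=
  ContinuousLinearMap.toContinuousLinearEquivOfDetNeZero _ (a.det_ne x hx)

lemma hasFDerivAt_act' (a : Trans X) {x : E} (hx : x ∈ a.dom) :
    HasFDerivAt a.act (a.derivEquiv hx : E →L[ℝ] E) x := by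
  simpa [derivEquiv] using a.hasFDerivAt_act hx

lemma isOpen_image (a : Trans X) {U : Set E} (hU : IsOpen U) (hUd : U ⊆ a.dom) :
    IsOpen (a.act '' U) := by
  have : CompleteSpace E := FiniteDimensional.complete ℝ E
  rw [isOpen_iff_mem_nhds]
  rintro _ ⟨x, hx, rfl⟩
  have h := ((a.contDiffAt_act (hUd hx)).hasStrictFDerivAt' (a.hasFDerivAt_act' (hUd hx))
    (by simp)).map_nhds_eq_of_equiv
  rw [← h]
  exact Filter.image_mem_map (hU.mem_nhds hx)

/-- `act` as an open partial homeomorphism. -/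
def toOPH (a : Trans X) : OpenPartialHomeomorph E E :=
  OpenPartialHomeomorph.ofContinuousOpenRestrict
    (a.inj.toPartialEquiv (f := a.act)) a.continuousOn_act
    (by
      intro V hV
      obtain ⟨W, hW, rfl⟩ := hV
      have := a.isOpen_image (hW.inter a.isOpen_dom) inter_subset_right
      convert this using 1
      ext y
      constructor
      · rintro ⟨⟨x, hx⟩, hxW, rfl⟩
        exact ⟨x, ⟨hxW, hx⟩, rfl⟩
      · rintro ⟨x, ⟨hxW, hx⟩, rfl⟩
        exact ⟨⟨x, hx⟩, hxW, rfl⟩)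
    a.isOpen_dom


/-- The product: first `a`, then `b`; `(t × t')_x = t_x + t'_{x'}` with `x' = x + t_x`. -/
instance : Mul (Trans X) where
  mul a b :=
    { dom := a.dom ∩ a.act ⁻¹' b.dom
      disp := (a.dom ∩ a.act ⁻¹' b.dom).indicator fun x => a.disp x + b.disp (a.act x)
      isOpen_dom := a.continuousOn_act.isOpen_inter_preimage a.isOpen_dom b.isOpen_dom
      dom_subset := fun _ hx => a.dom_subset hx.1
      smooth := by
        refine ContDiffOn.congr (f := fun x => a.disp x + b.disp (a.act x)) ?_
          fun x hx => indicator_of_mem hx _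
        intro x hx
        exact ((a.contDiffAt_disp hx.1).add
          ((b.contDiffAt_disp hx.2).comp x (a.contDiffAt_act hx.1))).contDiffWithinAt
      maps := by
        intro x hx
        rw [indicator_of_mem hx, ← add_assoc]
        exact b.maps _ hx.2
      inj := by
        intro x hx y hy h
        simp only [indicator_of_mem hx, indicator_of_mem hy, ← add_assoc] at h
        exact a.inj hx.1 hy.1 (b.inj hx.2 hy.2 h)
      det_ne := by
        intro x hx
        have hev : (a.dom ∩ a.act ⁻¹' b.dom).indicator
            (fun x => a.disp x + b.disp (a.act x)) =ᶠ[𝓝 x]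
              fun y => b.act (a.act y) - y := by
          filter_upwards [(a.continuousOn_act.isOpen_inter_preimage a.isOpen_dom
            b.isOpen_dom).mem_nhds hx] with y hy
          rw [indicator_of_mem hy]
          simp only [act]
          abel
        have hd : HasFDerivAt (fun y => b.act (a.act y) - y) _ x :=
          ((b.hasFDerivAt_act hx.2).comp x (a.hasFDerivAt_act hx.1)).sub (hasFDerivAt_id x)
        rw [hev.fderiv_eq, hd.fderiv, add_sub_cancel, ContinuousLinearMap.det,
          ContinuousLinearMap.toLinearMap_comp, LinearMap.det_comp]
        exact mul_ne_zero (b.det_ne _ hx.2) (a.det_ne _ hx.1)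
      disp_off := fun _ hx => indicator_of_notMem hx _ }

instance : One (Trans X) where
  one :=
    { dom := X
      disp := fun _ => 0
      isOpen_dom := X.isOpen
      dom_subset := subset_rfl
      smooth := contDiffOn_const
      maps := fun x hx => by simpa using hx
      inj := fun x _ y _ h => by simpa using h
      det_ne := fun x _ => by simp [ContinuousLinearMap.det]
      disp_off := fun _ _ => rfl }

/-- The inverse transformation of `act`, on the range of `a`. -/
def invAct (a : Trans X) : E → E := a.toOPH.symm

lemma invAct_act (a : Trans X) {x : E} (hx : x ∈ a.dom) : a.invAct (a.act x) = x :=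
  a.toOPH.left_inv hx

lemma hasFDerivAt_invAct (a : Trans X) {x : E} (hx : x ∈ a.dom) :
    HasFDerivAt a.invAct ((a.derivEquiv hx).symm : E →L[ℝ] E) (a.act x) := by
  refine a.toOPH.hasFDerivAt_symm (a := a.act x) ⟨x, hx, rfl⟩ ?_
  have hs : a.toOPH.symm (a.act x) = x := a.invAct_act hx
  rw [hs]
  exact a.hasFDerivAt_act' hx

lemma contDiffAt_invAct (a : Trans X) {x : E} (hx : x ∈ a.dom) :
    ContDiffAt ℝ ∞ a.invAct (a.act x) := by
  have : CompleteSpace E := FiniteDimensional.complete ℝ E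
  have hs : a.toOPH.symm (a.act x) = x := a.invAct_act hx
  refine a.toOPH.contDiffAt_symm (a := a.act x) (f₀' := a.derivEquiv hx) ⟨x, hx, rfl⟩ ?_ ?_
  · rw [hs]; exact a.hasFDerivAt_act' hx
  · rw [hs]; exact a.contDiffAt_act hx

instance : Inv (Trans X) where
  inv a :=
    { dom := a.act '' a.dom
      disp := (a.act '' a.dom).indicator fun y => a.invAct y - y
      isOpen_dom := a.isOpen_image a.isOpen_dom subset_rfl
      dom_subset := by
        rintro _ ⟨x, hx, rfl⟩
        exact a.maps x hx
      smooth := by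
        refine ContDiffOn.congr (f := fun y => a.invAct y - y) ?_
          fun x hx => indicator_of_mem hx _
        rintro _ ⟨x, hx, rfl⟩
        exact ((a.contDiffAt_invAct hx).sub contDiffAt_id).contDiffWithinAt
      maps := by
        rintro _ ⟨x, hx, rfl⟩
        rw [indicator_of_mem (mem_image_of_mem _ hx), a.invAct_act hx]
        simpa using a.dom_subset hx
      inj := by
        rintro _ ⟨x, hx, rfl⟩ _ ⟨y, hy, rfl⟩ h
        simp only [indicator_of_mem (mem_image_of_mem _ hx),
          indicator_of_mem (mem_image_of_mem _ hy), a.invAct_act hx, a.invAct_act hy] at h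
        simp only [add_sub_cancel] at h
        rw [h]
      det_ne := by
        rintro _ ⟨x, hx, rfl⟩
        have hev : (a.act '' a.dom).indicator (fun y => a.invAct y - y) =ᶠ[𝓝 (a.act x)]
              fun y => a.invAct y - y := by
          filter_upwards [(a.isOpen_image a.isOpen_dom subset_rfl).mem_nhds
            (mem_image_of_mem _ hx)] with y hy
          rw [indicator_of_mem hy]
        have hd : HasFDerivAt (fun y => a.invAct y - y) _ (a.act x) :=
          (a.hasFDerivAt_invAct hx).sub (hasFDerivAt_id _)
        rw [hev.fderiv_eq, hd.fderiv, add_sub_cancel]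
        exact (LinearEquiv.isUnit_det' (a.derivEquiv hx).symm.toLinearEquiv).ne_zero
      disp_off := fun _ hx => indicator_of_notMem hx _ }

lemma mul_dom (a b : Trans X) : (a * b).dom = a.dom ∩ a.act ⁻¹' b.dom := rfl

lemma mul_disp (a b : Trans X) {x : E} (hx : x ∈ (a * b).dom) :
    (a * b).disp x = a.disp x + b.disp (a.act x) :=
  indicator_of_mem (s := a.dom ∩ a.act ⁻¹' b.dom) hx fun x => a.disp x + b.disp (a.act x)

lemma mul_act (a b : Trans X) {x : E} (hx : x ∈ (a * b).dom) :
    (a * b).act x = b.act (a.act x) := by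
  simp only [act, mul_disp a b hx, add_assoc]

lemma one_dom : (1 : Trans X).dom = X := rfl

lemma one_act (x : E) : (1 : Trans X).act x = x := add_zero x

lemma inv_dom (a : Trans X) : a⁻¹.dom = a.act '' a.dom := rfl

lemma inv_act (a : Trans X) {x : E} (hx : x ∈ a.dom) : a⁻¹.act (a.act x) = x := by
  have h : a⁻¹.disp (a.act x) = a.invAct (a.act x) - a.act x :=
    indicator_of_mem (mem_image_of_mem _ hx) _
  rw [act, h, a.invAct_act hx, add_sub_cancel]

lemma act_mem (a : Trans X) {x : E} (hx : x ∈ a.dom) : a.act x ∈ X := a.maps x hx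

/-- Two elements with the same domain and the same action are equal. -/
lemma ext_act {a b : Trans X} (h : ∀ x, x ∈ a.dom ↔ x ∈ b.dom)
    (h' : ∀ x ∈ a.dom, x ∈ b.dom → a.act x = b.act x) : a = b := by
  have hd : a.dom = b.dom := Set.ext h
  ext x
  · exact h x
  · by_cases hx : x ∈ a.dom
    · exact add_left_cancel (h' x hx ((h x).1 hx))
    · rw [a.disp_off x hx, b.disp_off x (by rwa [← hd])]

lemma mem_mul {a b : Trans X} {x : E} :
    x ∈ (a * b).dom ↔ x ∈ a.dom ∧ a.act x ∈ b.dom := Iff.rfl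

lemma mem_mul_inv {a : Trans X} {x : E} : x ∈ (a * a⁻¹).dom ↔ x ∈ a.dom :=
  ⟨fun h => h.1, fun h => ⟨h, mem_image_of_mem _ h⟩⟩

lemma mul_inv_act {a : Trans X} {x : E} (hx : x ∈ a.dom) : (a * a⁻¹).act x = x := by
  rw [mul_act _ _ (mem_mul_inv.2 hx), inv_act _ hx]

lemma mem_mul_mul_left {a b c : Trans X} {x : E} :
    x ∈ (a * b * c).dom ↔ x ∈ a.dom ∧ a.act x ∈ b.dom ∧ b.act (a.act x) ∈ c.dom := by
  constructor
  · rintro ⟨h, h'⟩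
    rw [mem_preimage, mul_act _ _ h] at h'
    exact ⟨h.1, h.2, h'⟩
  · rintro ⟨h1, h2, h3⟩
    have h : x ∈ (a * b).dom := ⟨h1, h2⟩
    refine ⟨h, ?_⟩
    rwa [mem_preimage, mul_act _ _ h]

lemma mem_mul_mul_right {a b c : Trans X} {x : E} :
    x ∈ (a * (b * c)).dom ↔ x ∈ a.dom ∧ a.act x ∈ b.dom ∧ b.act (a.act x) ∈ c.dom := Iff.rfl

lemma mem_idem {a b : Trans X} {x : E} :
    x ∈ ((a * a⁻¹) * (b * b⁻¹)).dom ↔ x ∈ a.dom ∧ x ∈ b.dom := by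
  rw [mem_mul, mem_mul_inv, mem_mul_inv]
  constructor
  · rintro ⟨h, h'⟩
    rw [mul_inv_act h] at h'
    exact ⟨h, h'⟩
  · rintro ⟨h, h'⟩
    rw [mul_inv_act h]
    exact ⟨h, h'⟩

instance : PseudoGroup (Trans X) where
  mul_assoc a b c := by
    refine ext_act (fun x => by rw [mem_mul_mul_left, mem_mul_mul_right]) fun x hx hx' => ?_
    rw [mul_act _ _ hx, mul_act _ _ hx.1, mul_act _ _ hx', mul_act _ _ hx'.2]
  one_mul a := by
    refine ext_act (fun x => ?_) fun x hx _ => ?_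
    · rw [mem_mul, one_act]
      exact ⟨fun h => h.2, fun h => ⟨a.dom_subset h, h⟩⟩
    · rw [mul_act _ _ hx, one_act]
  mul_one a := by
    refine ext_act (fun x => ?_) fun x hx _ => ?_
    · rw [mem_mul]
      exact ⟨fun h => h.1, fun h => ⟨h, a.act_mem h⟩⟩
    · rw [mul_act _ _ hx, one_act]
  mul_inv_mul a := by
    refine ext_act (fun x => ?_) fun x hx hx' => ?_
    · rw [mem_mul, mem_mul_inv]
      exact ⟨fun h => h.1, fun h => ⟨h, by rwa [mul_inv_act h]⟩⟩
    · rw [mul_act _ _ hx, mul_inv_act hx']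
  inv_inv a := by
    have key : ∀ x ∈ a.dom, a⁻¹.act (a.act x) = x := fun x hx => inv_act a hx
    have hdom : ∀ x, x ∈ a⁻¹⁻¹.dom ↔ x ∈ a.dom := by
      intro x
      rw [inv_dom a⁻¹, inv_dom a]
      constructor
      · rintro ⟨_, ⟨y, hy, rfl⟩, rfl⟩
        rwa [key y hy]
      · intro hx
        exact ⟨a.act x, ⟨x, hx, rfl⟩, key x hx⟩
    refine ext_act hdom fun x _ hx => ?_
    have := inv_act a⁻¹ (x := a.act x) ⟨x, hx, rfl⟩
    rwa [key x hx] at this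
  mul_inv_rev a b := by
    have hdom : ∀ y, y ∈ (a * b)⁻¹.dom ↔
        ∃ x, x ∈ a.dom ∧ a.act x ∈ b.dom ∧ b.act (a.act x) = y := by
      intro y
      constructor
      · rintro ⟨x, hx, rfl⟩
        exact ⟨x, hx.1, hx.2, (mul_act _ _ hx).symm⟩
      · rintro ⟨x, h1, h2, rfl⟩
        exact ⟨x, ⟨h1, h2⟩, mul_act _ _ ⟨h1, h2⟩⟩
    refine ext_act (fun y => ?_) fun y hy hy' => ?_
    · rw [hdom, mem_mul]
      constructor
      · rintro ⟨x, h1, h2, rfl⟩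
        refine ⟨⟨_, h2, rfl⟩, ?_⟩
        rw [inv_act b h2]
        exact ⟨x, h1, rfl⟩
      · rintro ⟨⟨z, hz, rfl⟩, h⟩
        rw [inv_act b hz] at h
        obtain ⟨x, hx, rfl⟩ := h
        exact ⟨x, hx, hz, rfl⟩
    · obtain ⟨x, h1, h2, rfl⟩ := (hdom y).1 hy
      rw [mul_act _ _ hy', inv_act b h2, inv_act a h1, ← mul_act a b ⟨h1, h2⟩,
        inv_act (a * b) ⟨h1, h2⟩]
  idem_comm a b := by
    refine ext_act (fun x => by rw [mem_idem, mem_idem, and_comm]) fun x hx hx' => ?_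
    obtain ⟨ha, hb⟩ := mem_idem.1 hx
    rw [mul_act _ _ hx, mul_act _ _ hx', mul_inv_act ha, mul_inv_act hb, mul_inv_act ha]

end Trans

/-! ### The gauge group of translations and rotations `T^g ⋊ R^g`, as a local group -/

/-- A rotation of the Euclidean space `T`, as a continuous linear map. -/
def rotCLM (r : T ≃ₗᵢ[ℝ] T) : T →L[ℝ] T := r.toContinuousLinearEquiv

/-- An element of the generalized gauge group: a pair of a smooth displacement field and of a
smooth field `rot` of linear isometries of the Euclidean space `T`, on a common domain. -/
@[ext] structure Gauge (X : Opens E) (T : Type*) [NormedAddCommGroup T] [InnerProductSpace ℝ T]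
    extends Trans X where
  rot : E → T ≃ₗᵢ[ℝ] T
  rot_smooth : ContDiffOn ℝ ∞ (fun x => rotCLM (rot x)) dom
  rot_off : ∀ x ∉ dom, rot x = 1

namespace Gauge

variable {X : Opens E}

lemma contDiffAt_rot (a : Gauge X T) {x : E} (hx : x ∈ a.dom) :
    ContDiffAt ℝ ∞ (fun x => rotCLM (a.rot x)) x :=
  a.rot_smooth.contDiffAt (a.isOpen_dom.mem_nhds hx)

lemma rotCLM_mul (r s : T ≃ₗᵢ[ℝ] T) : rotCLM (r * s) = (rotCLM r).comp (rotCLM s) := rfl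

lemma rotCLM_inv (r : T ≃ₗᵢ[ℝ] T) :
    rotCLM r⁻¹ = ContinuousLinearMap.inverse (rotCLM r) := by
  rw [rotCLM, rotCLM, ContinuousLinearMap.inverse_equiv]
  rfl

/-- `(t, r) × (t', r') = (t_x + t'_{x'}, r_x ∘ r'_{x'})` with `x' = x + t_x`. -/
instance : Mul (Gauge X T) where
  mul a b :=
    { toTrans := a.toTrans * b.toTrans
      rot := (a.toTrans * b.toTrans).dom.mulIndicator fun x => a.rot x * b.rot (a.act x)
      rot_smooth := by
        refine ContDiffOn.congr
          (f := fun x => (rotCLM (a.rot x)).comp (rotCLM (b.rot (a.act x)))) ?_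
          fun x hx => by rw [mulIndicator_of_mem hx, rotCLM_mul]
        intro x hx
        exact ((a.contDiffAt_rot hx.1).clm_comp
          (ContDiffAt.comp (g := fun x => rotCLM (b.rot x)) x (b.contDiffAt_rot hx.2)
            (a.contDiffAt_act hx.1))).contDiffWithinAt
      rot_off := fun _ hx => mulIndicator_of_notMem hx _ }

instance : One (Gauge X T) where
  one :=
    { toTrans := 1
      rot := fun _ => 1
      rot_smooth := contDiffOn_const
      rot_off := fun _ _ => rfl }

instance : Inv (Gauge X T) where
  inv a :=
    { toTrans := a.toTrans⁻¹
      rot := a.toTrans⁻¹.dom.mulIndicator fun y => (a.rot (a.invAct y))⁻¹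
      rot_smooth := by
        refine ContDiffOn.congr
          (f := fun y => ContinuousLinearMap.inverse (rotCLM (a.rot (a.invAct y)))) ?_
          fun x hx => by rw [mulIndicator_of_mem hx, rotCLM_inv]
        rintro _ ⟨x, hx, rfl⟩
        have : CompleteSpace T := FiniteDimensional.complete ℝ T
        have h1 : ContDiffAt ℝ ∞ (fun y => rotCLM (a.rot (a.invAct y))) (a.act x) := by
          refine ContDiffAt.comp (g := fun x => rotCLM (a.rot x)) (a.act x) ?_
            (a.contDiffAt_invAct hx)
          rw [a.invAct_act hx]
          exact a.contDiffAt_rot hx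
        exact (ContDiffAt.comp (a.act x)
          (contDiffAt_map_inverse (a.rot (a.invAct (a.act x))).toContinuousLinearEquiv)
          h1).contDiffWithinAt
      rot_off := fun _ hx => mulIndicator_of_notMem hx _ }

lemma mul_toTrans (a b : Gauge X T) : (a * b).toTrans = a.toTrans * b.toTrans := rfl

lemma inv_toTrans (a : Gauge X T) : a⁻¹.toTrans = a.toTrans⁻¹ := rfl

lemma mul_rot (a b : Gauge X T) {x : E} (hx : x ∈ (a * b).dom) :
    (a * b).rot x = a.rot x * b.rot (a.act x) :=
  mulIndicator_of_mem (s := (a.toTrans * b.toTrans).dom) hx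
    fun x => a.rot x * b.rot (a.act x)

lemma one_rot (x : E) : (1 : Gauge X T).rot x = 1 := rfl

lemma inv_rot (a : Gauge X T) {x : E} (hx : x ∈ a.dom) :
    a⁻¹.rot (a.act x) = (a.rot x)⁻¹ := by
  have h : a⁻¹.rot (a.act x) = (a.rot (a.invAct (a.act x)))⁻¹ :=
    mulIndicator_of_mem (s := a.toTrans⁻¹.dom) (mem_image_of_mem _ hx)
      fun y => (a.rot (a.invAct y))⁻¹
  rw [h, a.invAct_act hx]

lemma ext_rot {a b : Gauge X T} (h : a.toTrans = b.toTrans)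
    (h' : ∀ x ∈ a.dom, x ∈ b.dom → a.rot x = b.rot x) : a = b := by
  have hd : a.dom = b.dom := by rw [h]
  apply Gauge.ext
  · exact hd
  · rw [h]
  · funext x
    by_cases hx : x ∈ a.dom
    · exact h' x hx (by rwa [← hd])
    · rw [a.rot_off x hx, b.rot_off x (by rwa [← hd])]

instance : PseudoGroup (Gauge X T) where
  mul_assoc a b c := by
    refine ext_rot (mul_assoc a.toTrans b.toTrans c.toTrans) fun x hx hx' => ?_
    rw [mul_rot _ _ hx, mul_rot _ _ hx.1, mul_rot _ _ hx', mul_rot _ _ hx'.2, mul_assoc,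
      mul_toTrans, Trans.mul_act _ _ hx.1]
  one_mul a := by
    refine ext_rot (one_mul a.toTrans) fun x hx _ => ?_
    rw [mul_rot _ _ hx, one_rot, one_mul]
    exact congrArg a.rot (Trans.one_act x)
  mul_one a := by
    refine ext_rot (mul_one a.toTrans) fun x hx _ => ?_
    rw [mul_rot _ _ hx, one_rot, mul_one]
  mul_inv_mul a := by
    refine ext_rot (PseudoGroup.mul_inv_mul a.toTrans) fun x hx hx' => ?_
    rw [mul_rot _ _ hx, mul_rot _ _ hx.1, inv_rot _ hx', mul_inv_cancel, one_mul, mul_toTrans,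
      inv_toTrans, Trans.mul_inv_act hx']
  inv_inv a := by
    refine ext_rot (PseudoGroup.inv_inv a.toTrans) fun x _ hx => ?_
    have h := inv_rot a⁻¹ (x := a.act x) ⟨x, hx, rfl⟩
    rw [inv_rot a hx, inv_toTrans, Trans.inv_act _ hx] at h
    simpa using h
  mul_inv_rev a b := by
    refine ext_rot (PseudoGroup.mul_inv_rev a.toTrans b.toTrans) fun y hy hy' => ?_
    obtain ⟨x, hx, rfl⟩ := hy
    have h := inv_rot (a * b) hx
    have hab : (a * b).act x = b.act (a.act x) := Trans.mul_act _ _ hx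
    change (a * b)⁻¹.rot ((a * b).act x) = (b⁻¹ * a⁻¹).rot ((a * b).act x)
    rw [h, mul_rot _ _ hx, mul_rot _ _ hy']
    change _ = b⁻¹.rot ((a * b).act x) * a⁻¹.rot (b⁻¹.act ((a * b).act x))
    rw [hab, inv_rot b hx.2, inv_toTrans, Trans.inv_act _ hx.2, inv_rot a hx.1,
      _root_.mul_inv_rev]
  idem_comm a b := by
    refine ext_rot (PseudoGroup.idem_comm a.toTrans b.toTrans) fun x hx hx' => ?_
    obtain ⟨ha, hb⟩ := Trans.mem_idem.1 hx
    have key : ∀ c : Gauge X T, x ∈ c.dom → (c * c⁻¹).rot x = 1 := by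
      intro c hc
      rw [mul_rot _ _ (Trans.mem_mul_inv.2 hc), inv_rot _ hc, mul_inv_cancel]
    rw [mul_rot _ _ hx, mul_rot _ _ hx', key a ha, key b hb, mul_toTrans, mul_toTrans,
      inv_toTrans, inv_toTrans, Trans.mul_inv_act ha, Trans.mul_inv_act hb, key a ha, key b hb]

/-- The gauge rotations `R^g`, as the subgroup of the elements with zero displacement. -/
def Rotations (X : Opens E) (T : Type*) [NormedAddCommGroup T] [InnerProductSpace ℝ T]
    [FiniteDimensional ℝ T] : Submonoid (Gauge X T) where
  carrier := {a | ∀ x, a.disp x = 0}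
  one_mem' := fun _ => rfl
  mul_mem' := by
    intro a b ha hb x
    by_cases hx : x ∈ (a * b).dom
    · have h := Trans.mul_disp a.toTrans b.toTrans hx
      rw [ha, hb, add_zero] at h
      exact h
    · exact (a * b).disp_off x hx

end Gauge

/-! ### Deformations -/

/-- A deformation: a family of maps `H x`, defined for all displacements that do not lead out of
the coordinate domain `X`, jointly smooth, with `H x 0 = 0`, and with each `H x` a diffeomorphism
onto its image in the parameter space `T`. -/
structure Deformation (X : Opens E) (T : Type*) [NormedAddCommGroup T] [InnerProductSpace ℝ T]
    where
  H : E → E → T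
  smooth : ContDiffOn ℝ ∞ (fun p : E × E => H p.1 p.2) {p | p.1 ∈ X ∧ p.1 + p.2 ∈ X}
  map_zero : ∀ x ∈ X, H x 0 = 0
  inj : ∀ x ∈ X, InjOn (H x) {s | x + s ∈ X}
  bijective_fderiv : ∀ x ∈ X, ∀ s, x + s ∈ X → Function.Bijective (fderiv ℝ (H x) s)

namespace Deformation

variable {X : Opens E} (D : Deformation X T)

/-- The parameters available at `x`: the range of `H x`. -/
def params (x : E) : Set T := D.H x '' {s | x + s ∈ X}

/-- `K x = (H x)⁻¹`, defined on `params x`. -/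
def K (x : E) : T → E := Function.invFunOn (D.H x) {s | x + s ∈ X}

lemma K_H {x s : E} (hx : x ∈ X) (hs : x + s ∈ X) : D.K x (D.H x s) = s :=
  (D.inj x hx).leftInvOn_invFunOn hs

/-- The action on points: `f_x(t) = x + K_x(t)`. -/
def f (x : E) (t : T) : E := x + D.K x t

/-- The multiplication law: `φ_x(t, t') = H_x(K_x(t) + K_{x'}(t'))` with `x' = f_x(t)`. -/
def φ (x : E) (t t' : T) : T := D.H x (D.K x t + D.K (D.f x t) t')

/-- The deformation coefficients `k_x = ∂K_x(0)`, which define the frame field `e_x`. -/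
def k (x : E) : T →L[ℝ] E := fderiv ℝ (D.K x) 0

/-- `h_x = ∂H_x(0)`, the inverse of `k_x`. -/
def h (x : E) : E →L[ℝ] T := fderiv ℝ (D.H x) 0

/-- The auxiliary map `λ_x(t) = ∂'φ_x(t, 0)`. -/
def lam (x : E) (t : T) : T →L[ℝ] T := fderiv ℝ (D.φ x t) 0

/-- The connection object in the frame `e_x`: `γ_x = ∂∂'φ_x(0, 0)`. -/
def gamma (x : E) : T →L[ℝ] T →L[ℝ] T := fderiv ℝ (D.lam x) 0

/-- The connection object in the coordinate frame: `Γ_x = k_x ∘ ∂²H_x(0)`. -/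
def Gam (x v w : E) : E := D.k x (fderiv ℝ (fderiv ℝ (D.H x)) 0 v w)

/-- The metric `g_x(v, w) = ⟨h_x v, h_x w⟩`. -/
def metric (x v w : E) : ℝ := inner ℝ (D.h x v) (D.h x w)

/-- The velocity of a curve (parameterized by `[0, 1]`) in the frame:
`τ_{c(s)} = h_{c(s)}(c'(s))`. -/
def vel (c : ℝ → E) (s : ℝ) : T := D.h (c s) (derivWithin c (Icc 0 1) s)

/-- A smooth curve `c` in `X` along which the law of composition is additive:
`c(s) = f_x(s τ_x)` and `φ_x(s τ_x, s' τ_{x'}) = (s + s') τ_x`, where `x = c(0)`, `x' = c(s)`. -/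
structure IsCanonicalCurve (c : ℝ → E) : Prop where
  smooth : ContDiffOn ℝ ∞ c (Icc 0 1)
  maps : ∀ s ∈ Icc (0 : ℝ) 1, c s ∈ X
  mem : ∀ s ∈ Icc (0 : ℝ) 1, s • D.vel c 0 ∈ D.params (c 0)
  point : ∀ s ∈ Icc (0 : ℝ) 1, D.f (c 0) (s • D.vel c 0) = c s
  mem' : ∀ s s' : ℝ, s ∈ Icc (0 : ℝ) 1 → s + s' ∈ Icc (0 : ℝ) 1 →
    s' • D.vel c s ∈ D.params (c s)
  comp : ∀ s s' : ℝ, s ∈ Icc (0 : ℝ) 1 → s + s' ∈ Icc (0 : ℝ) 1 →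
    D.φ (c 0) (s • D.vel c 0) (s' • D.vel c s) = (s + s') • D.vel c 0

/-- A canonical deformation: any two points are joined by a canonical curve. -/
def IsCanonical : Prop :=
  ∀ x ∈ X, ∀ x' ∈ X, ∃ c : ℝ → E, D.IsCanonicalCurve c ∧ c 0 = x ∧ c 1 = x'

/-- The deformation defines a group of Riemannian translations: it is canonical, and the length
of the unit of scale is preserved when it is transported along itself. -/
structure IsRiemannianTranslations : Prop where
  canonical : D.IsCanonical
  length : ∀ c : ℝ → E, D.IsCanonicalCurve c → ∀ s ∈ Icc (0 : ℝ) 1,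
    (inner ℝ (D.vel c s) (D.vel c s) : ℝ) = inner ℝ (D.vel c 0) (D.vel c 0)

end Deformation

/-- A deformation of the generalized gauge group: a deformation of the translations, and a smooth
family of rotations `π x t` of `T` with `π x 0 = 1`. -/
structure GaugeDeformation (X : Opens E) (T : Type*) [NormedAddCommGroup T]
    [InnerProductSpace ℝ T] extends Deformation X T where
  π : E → T → T ≃ₗᵢ[ℝ] T
  π_smooth : ContDiffOn ℝ ∞ (fun p : E × T => rotCLM (π p.1 p.2))
    {p | p.1 ∈ X ∧ p.2 ∈ toDeformation.params p.1}
  π_zero : ∀ x ∈ X, π x 0 = 1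

namespace GaugeDeformation

variable {X : Opens E} (P : GaugeDeformation X T)

/-- The multiplication law of the deformed group on the parameters `ϑ = (t, r)`. -/
def Φ (x : E) (ϑ ϑ' : T × (T ≃ₗᵢ[ℝ] T)) : T × (T ≃ₗᵢ[ℝ] T) :=
  (P.φ x ϑ.1 ϑ'.1,
    ϑ.2 * P.π x ϑ.1 * ϑ'.2 * P.π (P.f x ϑ.1) ϑ'.1 * (P.π x (P.φ x ϑ.1 ϑ'.1))⁻¹)

/-- The consistency condition `∇̄ = ∇` with the group defined by `D`: the frame fields coincide,
and so do, in this frame, the infinitesimal `λ`-transports of `D`, the infinitesimal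
`λ`-transports of the deformed translations, and the infinitesimal `π`-transports. -/
structure IsConsistent (D : Deformation X T) : Prop where
  frame : ∀ x ∈ X, P.k x = D.k x
  lam_transport : ∀ x ∈ X, P.gamma x = D.gamma x
  pi_transport : ∀ x ∈ X, fderiv ℝ (fun t => rotCLM (P.π x t)) 0 = D.gamma x

/-- The deformed group is a group of parallel transports over the group of Riemannian
translations defined by `D`: it is consistent with it, and satisfies the extended canonicity
condition `((s τ, 1) × (s' τ, 1))_x = ((s + s') τ_x, 1)` along a smooth curve joining any two
points. -/
structure IsParallelTransports (D : Deformation X T) : Prop where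
  consistent : P.IsConsistent D
  canonical : ∀ x ∈ X, ∀ x' ∈ X, ∃ c : ℝ → E, P.IsCanonicalCurve c ∧ c 0 = x ∧ c 1 = x' ∧
    ∀ s s' : ℝ, s ∈ Icc (0 : ℝ) 1 → s + s' ∈ Icc (0 : ℝ) 1 →
      P.Φ x (s • P.vel c 0, 1) (s' • P.vel c s, 1) = ((s + s') • P.vel c 0, 1)

end GaugeDeformation

/-! ### The deformed groups -/

/-- An element of the deformed group of translations: a parameter field `par`, of the form
`t_x = H_x(t̃_x)` with `t̃` in the gauge group of translations. -/
@[ext] structure DefTrans {X : Opens E} (D : Deformation X T) where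
  dom : Set E
  par : E → T
  exists_trans : ∃ a : Trans X, a.dom = dom ∧ ∀ x ∈ dom, par x = D.H x (a.disp x)
  par_off : ∀ x ∉ dom, par x = 0

namespace DefTrans

variable {X : Opens E} {D : Deformation X T}

/-- The deformation `t̃ ↦ t = H(t̃)` of the elements. -/
def ofTrans (D : Deformation X T) (a : Trans X) : DefTrans D where
  dom := a.dom
  par := a.dom.indicator fun x => D.H x (a.disp x)
  exists_trans := ⟨a, rfl, fun _ hx => indicator_of_mem hx _⟩
  par_off := fun _ hx => indicator_of_notMem hx _

lemma ofTrans_bijective (D : Deformation X T) : Function.Bijective (ofTrans D) := by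
  constructor
  · intro a b hab
    have hd : a.dom = b.dom := congrArg DefTrans.dom hab
    have hp : (ofTrans D a).par = (ofTrans D b).par := congrArg DefTrans.par hab
    ext x
    · rw [hd]
    · by_cases hx : x ∈ a.dom
      · have hx' : x ∈ b.dom := by rwa [← hd]
        have := congrFun hp x
        simp only [ofTrans, indicator_of_mem hx, indicator_of_mem hx'] at this
        exact D.inj x (a.dom_subset hx) (a.maps x hx) (b.maps x hx') this
      · rw [a.disp_off x hx, b.disp_off x (by rwa [← hd])]
  · rintro ⟨d, p, ⟨a, rfl, ha⟩, hoff⟩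
    refine ⟨a, ?_⟩
    ext x
    · rfl
    · by_cases hx : x ∈ a.dom
      · exact (indicator_of_mem hx fun x => D.H x (a.disp x)).trans (ha x hx).symm
      · exact (indicator_of_notMem hx fun x => D.H x (a.disp x)).trans (hoff x hx).symm

/-- The deformed group of translations is by definition isomorphic to the gauge group of
translations. -/
def equiv (D : Deformation X T) : Trans X ≃ DefTrans D := Equiv.ofBijective _ (ofTrans_bijective D)

instance : PseudoGroup (DefTrans D) := PseudoGroup.transfer (equiv D)

/-- The action on `X`. -/
def act (a : DefTrans D) (x : E) : E := D.f x (a.par x)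

lemma act_ofTrans (a : Trans X) {x : E} (hx : x ∈ a.dom) :
    (ofTrans D a).act x = a.act x := by
  have h : (ofTrans D a).par x = D.H x (a.disp x) :=
    indicator_of_mem hx fun x => D.H x (a.disp x)
  rw [act, h, Deformation.f, D.K_H (a.dom_subset hx) (a.maps x hx), Trans.act]

/-- The domain of a product. -/
lemma mem_mul {a b : DefTrans D} {x : E} :
    x ∈ (a * b).dom ↔ x ∈ a.dom ∧ a.act x ∈ b.dom := by
  obtain ⟨a, rfl⟩ := (equiv D).surjective a
  obtain ⟨b, rfl⟩ := (equiv D).surjective b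
  have h : equiv D a * equiv D b = equiv D (a * b) := by
    change equiv D ((equiv D).symm _ * (equiv D).symm _) = _
    simp
  rw [h]
  refine and_congr_right fun hx => ?_
  change a.act x ∈ b.dom ↔ (ofTrans D a).act x ∈ b.dom
  rw [act_ofTrans a hx]

/-- The multiplication law, pointwise. -/
lemma mul_par {a b : DefTrans D} {x : E} (hx : x ∈ (a * b).dom) :
    (a * b).par x = D.φ x (a.par x) (b.par (a.act x)) := by
  obtain ⟨hxa, hxb⟩ := mem_mul.1 hx
  obtain ⟨a, rfl⟩ := (equiv D).surjective a
  obtain ⟨b, rfl⟩ := (equiv D).surjective b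
  have h : equiv D a * equiv D b = equiv D (a * b) := by
    change equiv D ((equiv D).symm _ * (equiv D).symm _) = _
    simp
  have key : ∀ (c : Trans X) (y : E), y ∈ c.dom → (equiv D c).par y = D.H y (c.disp y) :=
    fun c y hy => indicator_of_mem hy fun x => D.H x (c.disp x)
  have hact : (equiv D a).act x = a.act x := act_ofTrans a hxa
  rw [hact] at hxb ⊢
  have hxab : x ∈ (a * b).dom := ⟨hxa, hxb⟩
  have hf : D.f x (D.H x (a.disp x)) = a.act x := by rw [← key a x hxa]; exact hact
  rw [h, key _ _ hxab, key _ _ hxa, key _ _ hxb, Deformation.φ, hf,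
    D.K_H (a.dom_subset hxa) (a.maps x hxa), D.K_H (b.dom_subset hxb) (b.maps _ hxb),
    Trans.mul_disp _ _ hxab]

end DefTrans

/-- An element of the deformed generalized gauge group: a pair of fields `par`, `rot` related by
`t_x = H_x(t̃_x)`, `r̃_x = r_x ∘ π_x(t_x)` to an element `(t̃, r̃)` of the generalized
gauge group. -/
@[ext] structure DefGauge {X : Opens E} (P : GaugeDeformation X T) where
  dom : Set E
  par : E → T
  rot : E → T ≃ₗᵢ[ℝ] T
  exists_gauge : ∃ a : Gauge X T, a.dom = dom ∧
    ∀ x ∈ dom, par x = P.H x (a.disp x) ∧ a.rot x = rot x * P.π x (par x)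
  par_off : ∀ x ∉ dom, par x = 0
  rot_off : ∀ x ∉ dom, rot x = 1

namespace DefGauge

variable {X : Opens E} {P : GaugeDeformation X T}

/-- The deformation `(t̃, r̃) ↦ (t, r)` of the elements. -/
def ofGauge (P : GaugeDeformation X T) (a : Gauge X T) : DefGauge P where
  dom := a.dom
  par := a.dom.indicator fun x => P.H x (a.disp x)
  rot := a.dom.mulIndicator fun x => a.rot x * (P.π x (P.H x (a.disp x)))⁻¹
  exists_gauge := ⟨a, rfl, fun _ hx => by
    rw [indicator_of_mem hx, mulIndicator_of_mem hx, inv_mul_cancel_right]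
    exact ⟨rfl, rfl⟩⟩
  par_off := fun _ hx => indicator_of_notMem hx _
  rot_off := fun _ hx => mulIndicator_of_notMem hx _

lemma ofGauge_bijective (P : GaugeDeformation X T) : Function.Bijective (ofGauge P) := by
  constructor
  · intro a b hab
    have hd : a.dom = b.dom := congrArg DefGauge.dom hab
    have hp : (ofGauge P a).par = (ofGauge P b).par := congrArg DefGauge.par hab
    have hr : (ofGauge P a).rot = (ofGauge P b).rot := congrArg DefGauge.rot hab
    have hdisp : ∀ x ∈ a.dom, a.disp x = b.disp x := by
      intro x hx
      have hx' : x ∈ b.dom := by rwa [← hd]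
      have := congrFun hp x
      simp only [ofGauge, indicator_of_mem hx, indicator_of_mem hx'] at this
      exact P.inj x (a.dom_subset hx) (a.maps x hx) (b.maps x hx') this
    have ht : a.toTrans = b.toTrans := by
      refine Trans.ext_act (fun x => by rw [hd]) fun x hx _ => ?_
      rw [Trans.act, Trans.act, hdisp x hx]
    refine Gauge.ext_rot ht fun x hx hx' => ?_
    have := congrFun hr x
    simp only [ofGauge, mulIndicator_of_mem hx, mulIndicator_of_mem hx', hdisp x hx] at this
    exact mul_right_cancel this
  · rintro ⟨d, p, r, ⟨a, rfl, ha⟩, hoff, hoff'⟩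
    refine ⟨a, ?_⟩
    apply DefGauge.ext
    · rfl
    · funext x
      by_cases hx : x ∈ a.dom
      · exact (indicator_of_mem hx fun x => P.H x (a.disp x)).trans (ha x hx).1.symm
      · exact (indicator_of_notMem hx fun x => P.H x (a.disp x)).trans (hoff x hx).symm
    · funext x
      by_cases hx : x ∈ a.dom
      · refine (mulIndicator_of_mem hx
          fun x => a.rot x * (P.π x (P.H x (a.disp x)))⁻¹).trans ?_
        rw [(ha x hx).2, ← (ha x hx).1, mul_inv_cancel_right]
      · exact (mulIndicator_of_notMem hx
          fun x => a.rot x * (P.π x (P.H x (a.disp x)))⁻¹).trans (hoff' x hx).symm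

/-- The deformed group is by definition isomorphic to the generalized gauge group. -/
def equiv (P : GaugeDeformation X T) : Gauge X T ≃ DefGauge P :=
  Equiv.ofBijective _ (ofGauge_bijective P)

instance : PseudoGroup (DefGauge P) := PseudoGroup.transfer (equiv P)

/-- The action on `X`. -/
def act (a : DefGauge P) (x : E) : E := P.f x (a.par x)

/-- The value `(t_x, r_x)` at `x`. -/
def val (a : DefGauge P) (x : E) : T × (T ≃ₗᵢ[ℝ] T) := (a.par x, a.rot x)

lemma act_ofGauge (a : Gauge X T) {x : E} (hx : x ∈ a.dom) :
    (ofGauge P a).act x = a.act x := by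
  have h : (ofGauge P a).par x = P.H x (a.disp x) :=
    indicator_of_mem hx fun x => P.H x (a.disp x)
  rw [act, h, Deformation.f, P.K_H (a.dom_subset hx) (a.maps x hx), Trans.act]

/-- The domain of a product. -/
lemma mem_mul {a b : DefGauge P} {x : E} :
    x ∈ (a * b).dom ↔ x ∈ a.dom ∧ a.act x ∈ b.dom := by
  obtain ⟨a, rfl⟩ := (equiv P).surjective a
  obtain ⟨b, rfl⟩ := (equiv P).surjective b
  have h : equiv P a * equiv P b = equiv P (a * b) := by
    change equiv P ((equiv P).symm _ * (equiv P).symm _) = _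
    simp
  rw [h]
  refine and_congr_right fun hx => ?_
  change a.act x ∈ b.dom ↔ (ofGauge P a).act x ∈ b.dom
  rw [act_ofGauge a hx]

/-- The multiplication law, pointwise. -/
lemma mul_val {a b : DefGauge P} {x : E} (hx : x ∈ (a * b).dom) :
    (a * b).val x = P.Φ x (a.val x) (b.val (a.act x)) := by
  obtain ⟨hxa, hxb⟩ := mem_mul.1 hx
  obtain ⟨a, rfl⟩ := (equiv P).surjective a
  obtain ⟨b, rfl⟩ := (equiv P).surjective b
  have h : equiv P a * equiv P b = equiv P (a * b) := by
    change equiv P ((equiv P).symm _ * (equiv P).symm _) = _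
    simp
  have key : ∀ (c : Gauge X T) (y : E), y ∈ c.dom → (equiv P c).val y =
      (P.H y (c.disp y), c.rot y * (P.π y (P.H y (c.disp y)))⁻¹) :=
    fun c y hy => Prod.ext (indicator_of_mem hy fun x => P.H x (c.disp x))
      (mulIndicator_of_mem hy fun x => c.rot x * (P.π x (P.H x (c.disp x)))⁻¹)
  have hact : (equiv P a).act x = a.act x := act_ofGauge a hxa
  rw [hact] at hxb ⊢
  have hxab : x ∈ (a * b).dom := ⟨hxa, hxb⟩
  have hf : P.f x (P.H x (a.disp x)) = a.act x := by
    rw [← hact, act]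
    exact congrArg (P.f x) (congrArg Prod.fst (key a x hxa)).symm
  have hd : (a * b).disp x = a.disp x + b.disp (a.act x) := Trans.mul_disp _ _ hxab
  have hφ : P.φ x (P.H x (a.disp x)) (P.H (a.act x) (b.disp (a.act x))) =
      P.H x (a.disp x + b.disp (a.act x)) := by
    rw [Deformation.φ, hf, P.K_H (a.dom_subset hxa) (a.maps x hxa),
      P.K_H (b.dom_subset hxb) (b.maps _ hxb)]
  rw [h, key _ _ hxab, key _ _ hxa, key _ _ hxb, hd, Gauge.mul_rot _ _ hxab]
  simp only [GaugeDeformation.Φ, hφ, hf, mul_assoc, inv_mul_cancel_left]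

/-- The action on tangent vectors, in the frame: `τ'_x = L_x(τ_{x'})`, `L_x = r_x ∘ π_x(t_x)`. -/
def L (a : DefGauge P) (x : E) : T ≃ₗᵢ[ℝ] T := a.rot x * P.π x (a.par x)

/-- The action on tangent vectors: it takes a vector `v` at the point `x' = act x` to a vector at
the point `x`. -/
def tangentAct (a : DefGauge P) (x : E) (v : E) : E := P.k x (a.L x (P.h (a.act x) v))

end DefGauge

/-! ### Riemannian geometry in the coordinate domain -/

/-- `g` is a (smooth) Riemannian metric on `X`. -/
structure IsRiemannianMetric (X : Opens E) (g : E → E → E → ℝ) : Prop where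
  smooth : ∀ v w, ContDiffOn ℝ ∞ (fun x => g x v w) X
  symm : ∀ x ∈ X, ∀ v w, g x v w = g x w v
  add_left : ∀ x ∈ X, ∀ u v w, g x (u + v) w = g x u w + g x v w
  smul_left : ∀ x ∈ X, ∀ (a : ℝ) (v w : E), g x (a • v) w = a * g x v w
  pos : ∀ x ∈ X, ∀ v, v ≠ 0 → 0 < g x v v

/-- `Γ` (bilinear at each point) is the Levi-Civita connection of `g`, in coordinates: it is
torsion-free and compatible with `g`. -/
structure IsLeviCivita (X : Opens E) (g : E → E → E → ℝ) (Γ : E → E → E → E) : Prop where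
  torsion_free : ∀ x ∈ X, ∀ v w, Γ x v w = Γ x w v
  compatible : ∀ x ∈ X, ∀ u v w,
    fderiv ℝ (fun y => g y v w) x u = g x (Γ x u v) w + g x v (Γ x u w)

/-- `c` is an affinely parameterized geodesic of the connection `Γ`, in `X`, on `[a, b]`. -/
structure IsGeodesic (X : Opens E) (Γ : E → E → E → E) (a b : ℝ) (c : ℝ → E) : Prop where
  smooth : ContDiffOn ℝ ∞ c (Icc a b)
  maps : ∀ s ∈ Icc a b, c s ∈ X
  equation : ∀ s ∈ Icc a b,
    derivWithin (derivWithin c (Icc a b)) (Icc a b) s +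
      Γ (c s) (derivWithin c (Icc a b) s) (derivWithin c (Icc a b) s) = 0

/-- The length of a tangent vector. -/
def vecLength (g : E → E → E → ℝ) (x v : E) : ℝ := √(g x v v)

/-- The angle between two tangent vectors (`π / 2` if one of them is zero). -/
def vecAngle (g : E → E → E → ℝ) (x v w : E) : ℝ :=
  Real.arccos (g x v w / (vecLength g x v * vecLength g x w))

/-- The length of a curve. -/
def curveLength (g : E → E → E → ℝ) (a b : ℝ) (c : ℝ → E) : ℝ :=
  ∫ s in a..b, vecLength g (c s) (derivWithin c (Icc a b) s)

/-- Moving a scale along itself by parallel transport: the scale `τ` at `x` is moved to the end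
point `x' = f_x(τ)`, and becomes there the vector `τ'` with `τ = π_x(τ)(τ')`. -/
def GaugeDeformation.moveScale {X : Opens E} (P : GaugeDeformation X T) (p : E × T) : E × T :=
  (P.f p.1 p.2, (P.π p.1 p.2)⁻¹ p.2)

end

end GaugeGeometry

open GaugeGeometry

set_option linter.unusedSectionVars false

namespace GaugeGeometry

variable {E : Type*} [NormedAddCommGroup E] [NormedSpace ℝ E] [FiniteDimensional ℝ E]
variable {T : Type*} [NormedAddCommGroup T] [InnerProductSpace ℝ T] [FiniteDimensional ℝ T]
variable {X : Opens E}

/-! ### Smoothness of `H`, its inverse, the frame and the connection object. -/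

namespace Deformation

variable (D : Deformation X T)

/-! The heart of the matter is rigidity: a canonical deformation is determined by its frame `k` and
its connection object `gamma`. Differentiating `lam` at the origin gives γ(hu, hv) = ∂²H(0)(u, v) −
(∂_u h)v (`gamma_h`). Equal frames on the open set `X` have equal derivatives, so the consistency
condition forces P and D to have the same second derivatives ∂²H(0), hence the same connection Γ.

Along a canonical curve the law of composition says H_{c(s)}(c(u) − c(s)) = (u − s)τ_{c(s)} for all
s and u. Differentiating once in u gives a constant, and differentiating again at u = s gives the
geodesic equation of Γ (`IsCanonicalCurve.isGeodesic`). Thus `H` is the inverse of an exponential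
map. Geodesics with the same initial data coincide, so two canonical deformations with the same Γ
and frame coincide. The delicate point is the domain: a parameter of one deformation must be shown
to be a parameter of the other, which is done by continuous induction along the geodesic
(`mem_params_of_canonicalCurve`, `IsCanonical.H_eq`). Hence P and D have the same `H` wherever it
matters, and the comparisons with `RT` follow.

The metric is Euclidean in the frame. Since γ = ∂π(0) is the derivative of a family of isometries,
it is skew; together with the symmetry of ∂²H(0) this says that Γ is the Levi-Civita connection.

For the scale moved along itself, the rotational part of extended canonicity makes s ↦ π_x(sτ)
multiplicative along the curve. Its derivative is governed by γ, and so is that of the velocity,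
with the opposite sign, so π_x(sτ)τ_{c(s)} is constant (`IsConsistent.π_vel`). Repeated steps
therefore run along one canonical curve. Lengths of general curves come from H_{c(s)}(c(u) − c(s))
being to first order h c'(s)(u − s), uniformly in s.

The group statements are read off the undeformed group: L = rπ(t) is just the undeformed rotation,
the projection forgets it, and translations embed with rotation 1. Congruent families of vectors are
superimposed by a constant displacement and a constant rotation, because families with the same Gram
matrix in T differ by an isometry. -/

lemma isOpen_domain (X : Opens E) : IsOpen {p : E × E | p.1 ∈ X ∧ p.1 + p.2 ∈ X} :=
  (X.isOpen.preimage continuous_fst).inter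
    (X.isOpen.preimage (continuous_fst.add continuous_snd))

lemma contDiffAt_uncurry {x s : E} (hx : x ∈ X) (hs : x + s ∈ X) :
    ContDiffAt ℝ ∞ (Function.uncurry D.H) (x, s) :=
  D.smooth.contDiffAt ((isOpen_domain X).mem_nhds ⟨hx, hs⟩)

lemma contDiffAt_H {x s : E} (hx : x ∈ X) (hs : x + s ∈ X) : ContDiffAt ℝ ∞ (D.H x) s :=
  (D.contDiffAt_uncurry hx hs).comp s (contDiffAt_const.prodMk contDiffAt_id)

lemma contDiffAt_uncurry_fderiv {x s : E} (hx : x ∈ X) (hs : x + s ∈ X) :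
    ContDiffAt ℝ ∞ (fun p : E × E => fderiv ℝ (D.H p.1) p.2) (x, s) := by
  refine ContDiffAt.fderiv (f := fun (p : E × E) (u : E) => D.H p.1 u) (g := Prod.snd)
    (n := ∞) ?_ contDiffAt_snd (by simp)
  exact ContDiffAt.comp (g := Function.uncurry D.H) (f := fun q : (E × E) × E => (q.1.1, q.2))
    ((x, s), s) (D.contDiffAt_uncurry hx hs) (by fun_prop)

lemma add_zero_mem {x : E} (hx : x ∈ X) : x + 0 ∈ X := by simpa using hx

lemma contDiffAt_h {x : E} (hx : x ∈ X) : ContDiffAt ℝ ∞ D.h x :=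
  ContDiffAt.comp (g := fun p : E × E => fderiv ℝ (D.H p.1) p.2) (f := fun y : E => (y, (0 : E)))
    x (D.contDiffAt_uncurry_fderiv hx (add_zero_mem hx)) (by fun_prop)

/-- The second derivative `∂²H_x(0)`. -/
noncomputable def hess (x : E) : E →L[ℝ] E →L[ℝ] T := fderiv ℝ (fderiv ℝ (D.H x)) 0

lemma contDiffAt_hess {x : E} (hx : x ∈ X) : ContDiffAt ℝ ∞ D.hess x := by
  refine ContDiffAt.fderiv (f := fun x => fderiv ℝ (D.H x)) (g := fun _ => (0 : E)) (n := ∞)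
    ?_ contDiffAt_const (by simp)
  exact D.contDiffAt_uncurry_fderiv hx (add_zero_mem hx)

lemma hess_symm {x : E} (hx : x ∈ X) (v w : E) : D.hess x v w = D.hess x w v :=
  (D.contDiffAt_H hx (add_zero_mem hx)).isSymmSndFDerivAt (by
    simp only [minSmoothness_of_isRCLikeNormedField]
    exact WithTop.coe_le_coe.2 (le_top (a := (2 : ℕ∞)))) v w

lemma hasFDerivAt_H {x s : E} (hx : x ∈ X) (hs : x + s ∈ X) :
    HasFDerivAt (D.H x) (fderiv ℝ (D.H x) s) s :=
  ((D.contDiffAt_H hx hs).differentiableAt (by simp)).hasFDerivAt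

lemma hasFDerivAt_fderiv_H {x : E} (hx : x ∈ X) :
    HasFDerivAt (fderiv ℝ (D.H x)) (D.hess x) 0 :=
  (((D.contDiffAt_H hx (add_zero_mem hx)).fderiv_right (m := ∞) (by simp)).differentiableAt
    (by simp)).hasFDerivAt

lemma H_sub_mem_params {x y : E} (hy : y ∈ X) : D.H x (y - x) ∈ D.params x :=
  ⟨y - x, by simpa using hy, rfl⟩

lemma K_H_sub {x y : E} (hx : x ∈ X) (hy : y ∈ X) : D.K x (D.H x (y - x)) = y - x :=
  D.K_H hx (by simpa using hy)

lemma f_H_sub {x y : E} (hx : x ∈ X) (hy : y ∈ X) : D.f x (D.H x (y - x)) = y := by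
  rw [f, D.K_H_sub hx hy, add_sub_cancel]

lemma f_mem {x : E} (hx : x ∈ X) {t : T} (ht : t ∈ D.params x) : D.f x t ∈ X := by
  obtain ⟨s, hs, rfl⟩ := ht
  rw [f, D.K_H hx hs]
  exact hs

lemma H_f_sub {x : E} (hx : x ∈ X) {t : T} (ht : t ∈ D.params x) :
    D.H x (D.f x t - x) = t := by
  obtain ⟨s, hs, rfl⟩ := ht
  rw [f, D.K_H hx hs, add_sub_cancel_left]

lemma f_injOn {x : E} (hx : x ∈ X) : InjOn (D.f x) (D.params x) := fun t ht t' ht' h => by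
  rw [← D.H_f_sub hx ht, ← D.H_f_sub hx ht', h]

lemma zero_mem_params {x : E} (hx : x ∈ X) : (0 : T) ∈ D.params x :=
  ⟨0, by simpa using hx, D.map_zero x hx⟩

lemma K_zero {x : E} (hx : x ∈ X) : D.K x 0 = 0 := by
  have := D.K_H hx (add_zero_mem hx)
  rwa [D.map_zero x hx] at this

lemma f_zero {x : E} (hx : x ∈ X) : D.f x 0 = x := by rw [f, D.K_zero hx, add_zero]

/-- The derivative of `H_x` as a continuous linear equivalence. -/
lemma exists_equiv {x s : E} (hx : x ∈ X) (hs : x + s ∈ X) :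
    ∃ e : E ≃L[ℝ] T, (e : E →L[ℝ] T) = fderiv ℝ (D.H x) s :=
  ⟨(LinearEquiv.ofBijective (fderiv ℝ (D.H x) s : E →ₗ[ℝ] T)
    (D.bijective_fderiv x hx s hs)).toContinuousLinearEquiv, by ext; rfl⟩

lemma map_nhds_H {x s : E} (hx : x ∈ X) (hs : x + s ∈ X) :
    Filter.map (D.H x) (𝓝 s) = 𝓝 (D.H x s) := by
  have : CompleteSpace E := FiniteDimensional.complete ℝ E
  obtain ⟨e, he⟩ := D.exists_equiv hx hs
  exact ((D.contDiffAt_H hx hs).hasStrictFDerivAt' (he ▸ D.hasFDerivAt_H hx hs)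
    (by simp)).map_nhds_eq_of_equiv

lemma isOpen_params {x : E} (hx : x ∈ X) : IsOpen (D.params x) := by
  rw [isOpen_iff_mem_nhds]
  rintro _ ⟨s, hs, rfl⟩
  rw [← D.map_nhds_H hx hs]
  exact Filter.image_mem_map
    ((X.isOpen.preimage (continuous_const.add continuous_id)).mem_nhds hs)

lemma eventually_K_H {x s : E} (hx : x ∈ X) (hs : x + s ∈ X) :
    ∀ᶠ u in 𝓝 s, D.K x (D.H x u) = u := by
  filter_upwards [(X.isOpen.preimage (continuous_const.add continuous_id)).mem_nhds hs] with u hu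
  exact D.K_H hx hu

lemma hasFDerivAt_K {x s : E} (hx : x ∈ X) (hs : x + s ∈ X) {e : E ≃L[ℝ] T}
    (he : (e : E →L[ℝ] T) = fderiv ℝ (D.H x) s) :
    HasFDerivAt (D.K x) (e.symm : T →L[ℝ] E) (D.H x s) := by
  have : CompleteSpace E := FiniteDimensional.complete ℝ E
  exact (((D.contDiffAt_H hx hs).hasStrictFDerivAt' (he ▸ D.hasFDerivAt_H hx hs)
    (by simp)).to_local_left_inverse (D.eventually_K_H hx hs)).hasFDerivAt

/-- `K` is defined by choice, so its smoothness comes from uniqueness of local inverses: near each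
parameter it must agree with the smooth inverse supplied by the inverse function theorem. -/
lemma contDiffAt_K {x : E} (hx : x ∈ X) {t : T} (ht : t ∈ D.params x) :
    ContDiffAt ℝ ∞ (D.K x) t := by
  have : CompleteSpace E := FiniteDimensional.complete ℝ E
  obtain ⟨s, hs, rfl⟩ := ht
  obtain ⟨e, he⟩ := D.exists_equiv hx hs
  have hd : HasFDerivAt (D.H x) (e : E →L[ℝ] T) s := he ▸ D.hasFDerivAt_H hx hs
  refine ((D.contDiffAt_H hx hs).to_localInverse hd (by simp)).congr_of_eventuallyEq ?_
  exact HasStrictFDerivAt.localInverse_unique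
    ((D.contDiffAt_H hx hs).hasStrictFDerivAt' hd (by simp)) (D.eventually_K_H hx hs)

lemma exists_equiv_h {x : E} (hx : x ∈ X) :
    ∃ e : E ≃L[ℝ] T, (e : E →L[ℝ] T) = D.h x ∧ (e.symm : T →L[ℝ] E) = D.k x := by
  obtain ⟨e, he⟩ := D.exists_equiv hx (add_zero_mem hx)
  have := D.hasFDerivAt_K hx (add_zero_mem hx) he
  rw [D.map_zero x hx] at this
  exact ⟨e, he, this.fderiv.symm⟩

lemma h_k {x : E} (hx : x ∈ X) (t : T) : D.h x (D.k x t) = t := by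
  obtain ⟨e, he, he'⟩ := D.exists_equiv_h hx
  rw [← he, ← he']
  simp

lemma k_h {x : E} (hx : x ∈ X) (v : E) : D.k x (D.h x v) = v := by
  obtain ⟨e, he, he'⟩ := D.exists_equiv_h hx
  rw [← he, ← he']
  simp

/-- Smoothness in the base point is obtained without differentiating `K` in x: on `X`, `k` is the
operator inverse of the smooth field `h`, and inversion is smooth at invertible maps. -/
lemma contDiffAt_k {x : E} (hx : x ∈ X) : ContDiffAt ℝ ∞ D.k x := by
  have : CompleteSpace E := FiniteDimensional.complete ℝ E
  obtain ⟨e, he, -⟩ := D.exists_equiv_h hx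
  have h1 : ContDiffAt ℝ ∞ (fun y => ContinuousLinearMap.inverse (D.h y)) x := by
    refine ContDiffAt.comp (g := ContinuousLinearMap.inverse) x ?_ (D.contDiffAt_h hx)
    exact he ▸ contDiffAt_map_inverse e
  refine h1.congr_of_eventuallyEq ?_
  filter_upwards [X.isOpen.mem_nhds hx] with y hy
  obtain ⟨e, he, he'⟩ := D.exists_equiv_h hy
  rw [← he, ← he', ContinuousLinearMap.inverse_equiv]

lemma hasFDerivAt_φ {x : E} (hx : x ∈ X) {t : T} (ht : t ∈ D.params x) :
    HasFDerivAt (D.φ x t) ((fderiv ℝ (D.H x) (D.K x t)).comp (D.k (D.f x t))) 0 := by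
  have hy := D.f_mem hx ht
  have hK : HasFDerivAt (fun t' => D.K x t + D.K (D.f x t) t') (D.k (D.f x t)) 0 :=
    (((D.contDiffAt_K hy (D.zero_mem_params hy)).differentiableAt
      (by simp)).hasFDerivAt : HasFDerivAt (D.K (D.f x t)) (D.k (D.f x t)) 0).const_add _
  refine HasFDerivAt.comp (g := D.H x) 0 ?_ hK
  rw [D.K_zero hy, add_zero]
  exact D.hasFDerivAt_H hx hy

lemma lam_eq {x : E} (hx : x ∈ X) {t : T} (ht : t ∈ D.params x) :
    D.lam x t = (fderiv ℝ (D.H x) (D.K x t)).comp (D.k (D.f x t)) :=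
  (D.hasFDerivAt_φ hx ht).fderiv

/-- The connection object in the frame, in terms of the derivatives of `H` and `h`. -/
lemma gamma_h {x : E} (hx : x ∈ X) (u v : E) :
    D.gamma x (D.h x u) (D.h x v) = D.hess x u v - fderiv ℝ D.h x u v := by
  have h0 := D.zero_mem_params hx
  have hK : HasFDerivAt (D.K x) (D.k x) 0 :=
    ((D.contDiffAt_K hx h0).differentiableAt (by simp)).hasFDerivAt
  have hf : HasFDerivAt (D.f x) (D.k x) 0 := hK.const_add x
  have hk : HasFDerivAt D.k (fderiv ℝ D.k x) (D.f x 0) := by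
    rw [D.f_zero hx]
    exact ((D.contDiffAt_k hx).differentiableAt (by simp)).hasFDerivAt
  have hH : HasFDerivAt (fderiv ℝ (D.H x)) (D.hess x) (D.K x 0) := by
    rw [D.K_zero hx]
    exact D.hasFDerivAt_fderiv_H hx
  have hlam := (hH.comp (0 : T) hK).clm_comp (hk.comp (0 : T) hf)
  have hev : D.lam x =ᶠ[𝓝 0]
      fun t => ((fderiv ℝ (D.H x) ∘ D.K x) t).comp ((D.k ∘ D.f x) t) := by
    filter_upwards [(D.isOpen_params hx).mem_nhds h0] with t ht
    exact D.lam_eq hx ht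
  have hg := (hlam.congr_of_eventuallyEq hev).fderiv
  -- The derivative of `lam` contains a derivative of `k`. Differentiating the identity k_y h_y v =
  -- v in y replaces (∂_u k)(h v) by −k((∂_u h) v).
  have hconst : HasFDerivAt (fun y => D.k y (D.h y v))
      ((D.k x).comp ((fderiv ℝ D.h x).flip v) + ((fderiv ℝ D.k x).flip (D.h x v))) x :=
    (((D.contDiffAt_k hx).differentiableAt (by simp)).hasFDerivAt).clm_apply
      ((((D.contDiffAt_h hx).differentiableAt (by simp)).hasFDerivAt).clm_apply
        (hasFDerivAt_const v x)) |>.congr_fderiv (by ext; simp)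
  have hz : fderiv ℝ (fun y => D.k y (D.h y v)) x = 0 := by
    have : (fun y => D.k y (D.h y v)) =ᶠ[𝓝 x] fun _ => v := by
      filter_upwards [X.isOpen.mem_nhds hx] with y hy
      exact D.k_h hy v
    rw [this.fderiv_eq]
    simp
  have hrel := DFunLike.congr_fun (hconst.fderiv.symm.trans hz) u
  simp only [add_apply, ContinuousLinearMap.comp_apply,
    ContinuousLinearMap.flip_apply, zero_apply] at hrel
  have hrel' := congrArg (D.h x) (eq_neg_of_add_eq_zero_right hrel)
  rw [_root_.map_neg, D.h_k hx] at hrel'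
  rw [gamma, hg]
  have hh : fderiv ℝ (D.H x) 0 = D.h x := rfl
  simp [D.K_zero hx, D.f_zero hx, D.k_h hx, hh, hrel']
  abel

/-! ### The metric and its Levi-Civita connection. -/

lemma Gam_eq (x v w : E) : D.Gam x v w = D.k x (D.hess x v w) := rfl

lemma Gam_symm {x : E} (hx : x ∈ X) (v w : E) : D.Gam x v w = D.Gam x w v := by
  rw [Gam_eq, Gam_eq, D.hess_symm hx]

lemma fderiv_metric {x : E} (hx : x ∈ X) (v w : E) (u : E) :
    fderiv ℝ (fun y => D.metric y v w) x u =
      inner ℝ (fderiv ℝ D.h x u v) (D.h x w) + inner ℝ (D.h x v) (fderiv ℝ D.h x u w) := by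
  have hd := ((D.contDiffAt_h hx).differentiableAt (by simp)).hasFDerivAt
  have := ((hd.clm_apply (hasFDerivAt_const v x)).inner ℝ
    (hd.clm_apply (hasFDerivAt_const w x))).fderiv
  rw [show (fun y => D.metric y v w) = fun y => inner ℝ (D.h y v) (D.h y w) from rfl, this]
  simp [add_comm]

lemma isRiemannianMetric : IsRiemannianMetric X D.metric where
  smooth v w x hx := ((((D.contDiffAt_h hx).clm_apply contDiffAt_const).inner ℝ
    ((D.contDiffAt_h hx).clm_apply contDiffAt_const))).contDiffWithinAt
  symm x _ v w := real_inner_comm _ _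
  add_left x _ u v w := by simp [metric, inner_add_left]
  smul_left x _ a v w := by simp [metric, inner_smul_left]
  pos x hx v hv := by
    refine real_inner_self_pos.2 fun h => hv ?_
    rw [← D.k_h hx v, h, _root_.map_zero]

lemma metric_k {x : E} (hx : x ∈ X) (τ τ' : T) :
    D.metric x (D.k x τ) (D.k x τ') = inner ℝ τ τ' := by
  rw [metric, D.h_k hx, D.h_k hx]

/-- If the infinitesimal transports are skew, the connection is the Levi-Civita connection. -/
lemma isLeviCivita (hskew : ∀ x ∈ X, ∀ t a b : T,
    (inner ℝ (D.gamma x t a) b : ℝ) + inner ℝ a (D.gamma x t b) = 0) :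
    IsLeviCivita X D.metric D.Gam where
  torsion_free x hx v w := D.Gam_symm hx v w
  compatible x hx u v w := by
    -- In terms of `hess` and the derivative of `h`, skewness says that ∂h may be replaced by ∂²H(0)
    -- in the derivative of the metric; and ∂²H(0) = h ∘ Γ.
    have := hskew x hx (D.h x u) (D.h x v) (D.h x w)
    rw [D.gamma_h hx, D.gamma_h hx, inner_sub_left, inner_sub_right] at this
    rw [D.fderiv_metric hx, metric, metric, Gam_eq, Gam_eq, D.h_k hx, D.h_k hx]
    linarith

lemma h_eq_of_k_eq {D' : Deformation X T} {x : E} (hx : x ∈ X) (hk : D.k x = D'.k x) :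
    D.h x = D'.h x := by
  ext v
  conv_lhs => rw [← D'.k_h hx v, ← hk, D.h_k hx]

/-- `gamma_h` can be solved for `hess`: the remaining term depends only on the field `h` near x,
which the frame determines because `X` is open. -/
lemma hess_eq_of_gamma_eq {D' : Deformation X T} (hk : ∀ x ∈ X, D.k x = D'.k x)
    (hg : ∀ x ∈ X, D.gamma x = D'.gamma x) {x : E} (hx : x ∈ X) : D.hess x = D'.hess x := by
  have hh : ∀ y ∈ X, D.h y = D'.h y := fun y hy => D.h_eq_of_k_eq hy (hk y hy)
  have hd : fderiv ℝ D.h x = fderiv ℝ D'.h x := by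
    refine Filter.EventuallyEq.fderiv_eq ?_
    filter_upwards [X.isOpen.mem_nhds hx] with y hy using hh y hy
  ext u v
  have h1 := D.gamma_h hx u v
  have h2 := D'.gamma_h hx u v
  rw [hg x hx, hh x hx, h2, hd] at h1
  exact (sub_left_inj.1 h1).symm

end Deformation

/-! ### Canonical curves are geodesics. -/

namespace Deformation.IsCanonicalCurve

variable {D : Deformation X T} {c : ℝ → E}

/-- Moves the base point of the canonicity condition from `c 0` to `c s`. By `comp`, the points `c
u` and f_{c(s)}((u − s)τ_{c(s)}) have the same image under H_{c(0)}, which is injective. Here u may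
lie on either side of s. -/
lemma H_sub (hc : D.IsCanonicalCurve c) {s u : ℝ} (hs : s ∈ Icc (0 : ℝ) 1)
    (hu : u ∈ Icc (0 : ℝ) 1) : D.H (c s) (c u - c s) = (u - s) • D.vel c s := by
  have h0 : c 0 ∈ X := hc.maps 0 (by simp)
  have hu' : s + (u - s) ∈ Icc (0 : ℝ) 1 := by simpa using hu
  have hm := hc.mem' s (u - s) hs hu'
  have hcomp := hc.comp s (u - s) hs hu'
  have hf : D.f (c s) ((u - s) • D.vel c s) = c u := by
    have hy := D.f_mem (hc.maps s hs) hm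
    have e1 : D.H (c 0) (D.f (c s) ((u - s) • D.vel c s) - c 0) = u • D.vel c 0 := by
      rw [φ, hc.point s hs] at hcomp
      rw [show s + (u - s) = u by ring] at hcomp
      rw [← hcomp]
      congr 1
      have := hc.point s hs
      rw [f] at this ⊢
      rw [← this]
      abel
    have e2 := D.H_f_sub h0 (hc.mem u hu)
    rw [hc.point u hu, ← e1] at e2
    have := D.inj (c 0) h0 (by simpa using hc.maps u hu) (by simpa using hy) e2
    exact (sub_left_inj.1 this).symm
  rw [← hf, D.H_f_sub (hc.maps s hs) hm]

lemma hasDerivWithinAt (hc : D.IsCanonicalCurve c) {u : ℝ} (hu : u ∈ Icc (0 : ℝ) 1) :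
    HasDerivWithinAt c (derivWithin c (Icc 0 1) u) (Icc 0 1) u :=
  ((hc.smooth u hu).differentiableWithinAt (by simp)).hasDerivWithinAt

lemma contDiffOn_derivWithin (hc : D.IsCanonicalCurve c) :
    ContDiffOn ℝ ∞ (derivWithin c (Icc 0 1)) (Icc 0 1) :=
  hc.smooth.derivWithin (uniqueDiffOn_Icc one_pos) (by simp)

lemma hasDerivWithinAt_derivWithin (hc : D.IsCanonicalCurve c) {u : ℝ}
    (hu : u ∈ Icc (0 : ℝ) 1) :
    HasDerivWithinAt (derivWithin c (Icc 0 1))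
      (derivWithin (derivWithin c (Icc 0 1)) (Icc 0 1) u) (Icc 0 1) u :=
  ((hc.contDiffOn_derivWithin u hu).differentiableWithinAt (by simp)).hasDerivWithinAt

/-- The derivative of `H_sub` in the end point u. The result does not depend on u; this constancy is
what yields the geodesic equation and the transport of the velocity by `lam`. -/
lemma fderiv_H_derivWithin (hc : D.IsCanonicalCurve c) {s u : ℝ} (hs : s ∈ Icc (0 : ℝ) 1)
    (hu : u ∈ Icc (0 : ℝ) 1) :
    fderiv ℝ (D.H (c s)) (c u - c s) (derivWithin c (Icc 0 1) u) = D.vel c s := by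
  have h1 : HasDerivWithinAt (fun u => D.H (c s) (c u - c s))
      (fderiv ℝ (D.H (c s)) (c u - c s) (derivWithin c (Icc 0 1) u)) (Icc 0 1) u :=
    (D.hasFDerivAt_H (hc.maps s hs) (by simpa using hc.maps u hu)).comp_hasDerivWithinAt u
      ((hc.hasDerivWithinAt hu).sub_const _)
  have h2 : HasDerivWithinAt (fun u => (u - s) • D.vel c s) ((1 : ℝ) • D.vel c s)
      (Icc 0 1) u := (((hasDerivWithinAt_id u _).sub_const s).smul_const _)
  rw [one_smul] at h2
  exact ((uniqueDiffOn_Icc one_pos) u hu).eq_deriv _ h1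
    (h2.congr (fun v hv => hc.H_sub hs hv) (hc.H_sub hs hu))

/-- Differentiate the constancy in `fderiv_H_derivWithin` at u = s: ∂²H(0)(c', c') + h c'' = 0.
Applying `k` turns this into the geodesic equation. -/
lemma isGeodesic (hc : D.IsCanonicalCurve c) : IsGeodesic X D.Gam 0 1 c where
  smooth := hc.smooth
  maps := hc.maps
  equation s hs := by
    have hH : HasFDerivAt (fderiv ℝ (D.H (c s))) (D.hess (c s)) (c s - c s) := by
      rw [sub_self]
      exact D.hasFDerivAt_fderiv_H (hc.maps s hs)
    have h1 := (hH.comp_hasDerivWithinAt (f := fun u => c u - c s) s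
      ((hc.hasDerivWithinAt hs).sub_const (c s))).clm_apply (hc.hasDerivWithinAt_derivWithin hs)
    have h2 := ((hasDerivWithinAt_const s (Icc (0 : ℝ) 1) (D.vel c s))).congr
      (fun v hv => hc.fderiv_H_derivWithin hs hv) (hc.fderiv_H_derivWithin hs hs)
    have h3 := ((uniqueDiffOn_Icc one_pos) s hs).eq_deriv _ h1 h2
    have h4 := congrArg (D.k (c s)) h3
    simp only [Function.comp_apply, sub_self, _root_.map_add, _root_.map_zero] at h4
    have hk := D.k_h (hc.maps s hs)
      (derivWithin (derivWithin c (Icc 0 1)) (Icc 0 1) s)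
    rw [show D.h (c s) = fderiv ℝ (D.H (c s)) 0 from rfl] at hk
    rw [hk] at h4
    rw [Gam_eq, add_comm]
    exact h4

/-- The initial velocity of a canonical curve is the parameter of its end point. -/
lemma vel_zero_eq (hc : D.IsCanonicalCurve c) {t : T} (ht : t ∈ D.params (c 0))
    (h1 : c 1 = D.f (c 0) t) : D.vel c 0 = t := by
  have hm := hc.mem 1 (by simp)
  have hp := hc.point 1 (by simp)
  rw [one_smul] at hm hp
  exact D.f_injOn (hc.maps 0 (by simp)) hm ht (hp.trans h1)

lemma derivWithin_eq (hc : D.IsCanonicalCurve c) {s : ℝ} (hs : s ∈ Icc (0 : ℝ) 1) :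
    derivWithin c (Icc 0 1) s = D.k (c s) (D.vel c s) := (D.k_h (hc.maps s hs) _).symm

end Deformation.IsCanonicalCurve

namespace Deformation

variable {D : Deformation X T}

/-- Join x to f_x(t): the initial velocity of the curve is itself a parameter of the end point, so
it is t by injectivity. -/
lemma IsCanonical.exists_curve (hD : D.IsCanonical) {x : E} (hx : x ∈ X) {t : T}
    (ht : t ∈ D.params x) : ∃ c, D.IsCanonicalCurve c ∧ c 0 = x ∧ D.vel c 0 = t := by
  obtain ⟨c, hc, rfl, h1⟩ := hD x hx _ (D.f_mem hx ht)
  exact ⟨c, hc, rfl, hc.vel_zero_eq ht h1⟩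

variable (D)

lemma Gam_smul (x v : E) (r : ℝ) : D.Gam x (r • v) (r • v) = (r * r) • D.Gam x v v := by
  simp [Gam_eq, smul_smul]

lemma contDiffAt_Gam {x : E} (hx : x ∈ X) (v : E) :
    ContDiffAt ℝ ∞ (fun p : E × E => D.Gam p.1 p.2 p.2) (x, v) := by
  have h1 : ContDiffAt ℝ ∞ (fun p : E × E => D.k p.1) (x, v) :=
    ContDiffAt.comp (g := D.k) (x, v) (D.contDiffAt_k hx) contDiffAt_fst
  have h2 : ContDiffAt ℝ ∞ (fun p : E × E => D.hess p.1) (x, v) :=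
    ContDiffAt.comp (g := D.hess) (x, v) (D.contDiffAt_hess hx) contDiffAt_fst
  exact h1.clm_apply ((h2.clm_apply contDiffAt_snd).clm_apply contDiffAt_snd)

end Deformation

/-- Affine reparametrization of a derivative. -/
lemma hasDerivWithinAt_comp_mul {F : Type*} [NormedAddCommGroup F] [NormedSpace ℝ F]
    {c : ℝ → F} {c' : F} {b b' r s : ℝ} (hr : 0 ≤ r) (hrb : r * b' ≤ b)
    (hc : HasDerivWithinAt c c' (Icc 0 b) (r * s)) :
    HasDerivWithinAt (fun s => c (r * s)) (r • c') (Icc 0 b') s := by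
  have h : HasDerivWithinAt (fun s : ℝ => r * s) r (Icc 0 b') s := by
    simpa using ((hasDerivWithinAt_id s (Icc 0 b')).const_mul r)
  exact hc.scomp s h fun u hu =>
    ⟨mul_nonneg hr hu.1, (mul_le_mul_of_nonneg_left hu.2 hr).trans hrb⟩

lemma derivWithin_comp_mul {F : Type*} [NormedAddCommGroup F] [NormedSpace ℝ F]
    {c : ℝ → F} {b b' r s : ℝ} (hr : 0 ≤ r) (hb' : 0 < b') (hrb : r * b' ≤ b)
    (hc : DifferentiableOn ℝ c (Icc 0 b)) (hs : s ∈ Icc 0 b') :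
    derivWithin (fun s => c (r * s)) (Icc 0 b') s = r • derivWithin c (Icc 0 b) (r * s) :=
  (hasDerivWithinAt_comp_mul hr hrb (hc (r * s) ⟨mul_nonneg hr hs.1,
    (mul_le_mul_of_nonneg_left hs.2 hr).trans hrb⟩).hasDerivWithinAt).derivWithin
    (uniqueDiffOn_Icc hb' s hs)

/-! ### Reparametrization and uniqueness of geodesics. -/

namespace IsGeodesic

variable {Γ : E → E → E → E} {b b' : ℝ} {c c₁ c₂ : ℝ → E}

lemma comp_mul {r : ℝ} (hΓ : ∀ x v, Γ x (r • v) (r • v) = (r * r) • Γ x v v)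
    (hc : IsGeodesic X Γ 0 b c) (hr : 0 < r) (hb' : 0 < b') (hrb : r * b' ≤ b) :
    IsGeodesic X Γ 0 b' (fun s => c (r * s)) := by
  have hmap : MapsTo (fun s => r * s) (Icc 0 b') (Icc 0 b) := fun u hu =>
    ⟨mul_nonneg hr.le hu.1, (mul_le_mul_of_nonneg_left hu.2 hr.le).trans hrb⟩
  have hb : 0 < b := (mul_pos hr hb').trans_le hrb
  refine ⟨hc.smooth.comp (by fun_prop) hmap, fun s hs => hc.maps _ (hmap hs), fun s hs => ?_⟩
  have hd1 : ∀ u ∈ Icc 0 b', derivWithin (fun s => c (r * s)) (Icc 0 b') u =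
      r • derivWithin c (Icc 0 b) (r * u) := fun u hu =>
    derivWithin_comp_mul hr.le hb' hrb (hc.smooth.differentiableOn (by simp)) hu
  have hd : DifferentiableOn ℝ (derivWithin c (Icc 0 b)) (Icc 0 b) :=
    (hc.smooth.derivWithin (m := ∞) (uniqueDiffOn_Icc hb) (by simp)).differentiableOn (by simp)
  have hd2 := ((hasDerivWithinAt_comp_mul hr.le hrb
    (hd _ (hmap hs)).hasDerivWithinAt).const_smul r).derivWithin (uniqueDiffOn_Icc hb' s hs)
  rw [derivWithin_congr hd1 (hd1 s hs), hd1 s hs, hΓ]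
  exact (congrArg (· + _) hd2).trans
    (by rw [smul_smul, ← smul_add, hc.equation _ (hmap hs), smul_zero])

/-- A geodesic is determined by its initial position and velocity. -/
lemma eqOn (hΓ : ∀ x ∈ X, ∀ v, ContDiffAt ℝ 1 (fun p : E × E => Γ p.1 p.2 p.2) (x, v))
    (hb : 0 < b) (h₁ : IsGeodesic X Γ 0 b c₁) (h₂ : IsGeodesic X Γ 0 b c₂)
    (h0 : c₁ 0 = c₂ 0) (h0' : derivWithin c₁ (Icc 0 b) 0 = derivWithin c₂ (Icc 0 b) 0) :
    EqOn c₁ c₂ (Icc 0 b) := by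
  let F : E × E → E × E := fun p => (p.2, -Γ p.1 p.2 p.2)
  let z : (ℝ → E) → ℝ → E × E := fun c s => (c s, derivWithin c (Icc 0 b) s)
  have hcd : ∀ c, IsGeodesic X Γ 0 b c →
      ContDiffOn ℝ ∞ (derivWithin c (Icc 0 b)) (Icc 0 b) := fun c hc =>
    hc.smooth.derivWithin (uniqueDiffOn_Icc hb) (by simp)
  have hz : ∀ c, IsGeodesic X Γ 0 b c → ContinuousOn (z c) (Icc 0 b) := fun c hc =>
    hc.smooth.continuousOn.prodMk (hcd c hc).continuousOn
  have hz' : ∀ c, IsGeodesic X Γ 0 b c → ∀ s ∈ Ico 0 b,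
      HasDerivWithinAt (z c) (F (z c s)) (Ici s) s := by
    intro c hc s hs
    have hs' : s ∈ Icc 0 b := ⟨hs.1, hs.2.le⟩
    have e := hc.equation s hs'
    have d1 := ((hc.smooth s hs').differentiableWithinAt (by simp)).hasDerivWithinAt
    have d2 := ((hcd c hc s hs').differentiableWithinAt (by simp)).hasDerivWithinAt
    rw [eq_neg_of_add_eq_zero_left e] at d2
    have d3 : HasDerivWithinAt (z c) (F (z c s)) (Icc 0 b) s := d1.prodMk d2
    -- The uniqueness theorem for ODEs wants right derivatives; for s < b the interval is a
    -- neighbourhood of s within `Ici s`.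
    refine d3.mono_of_mem_nhdsWithin ?_
    exact Filter.mem_of_superset (Icc_mem_nhdsGE hs.2) (Icc_subset_Icc_left hs.1)
  -- Γ is regular only over `X` and no global Lipschitz bound is at hand. On the compact union of
  -- the two phase curves, local Lipschitz continuity of the field gives a uniform constant.
  let K := z c₁ '' Icc 0 b ∪ z c₂ '' Icc 0 b
  have hK : IsCompact K := (isCompact_Icc.image_of_continuousOn (hz _ h₁)).union
    (isCompact_Icc.image_of_continuousOn (hz _ h₂))
  have hKX : ∀ p ∈ K, p.1 ∈ X := by
    rintro _ (⟨s, hs, rfl⟩ | ⟨s, hs, rfl⟩)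
    exacts [h₁.maps s hs, h₂.maps s hs]
  have hF : LocallyLipschitzOn K F := by
    intro p hp
    obtain ⟨C, t, ht, hL⟩ := (contDiffAt_snd.prodMk (hΓ p.1 (hKX p hp) p.2).neg :
      ContDiffAt ℝ 1 F p).exists_lipschitzOnWith
    exact ⟨C, t, mem_nhdsWithin_of_mem_nhds ht, hL⟩
  obtain ⟨C, hC⟩ := hF.exists_lipschitzOnWith_of_compact hK
  have hEq := ODE_solution_unique_of_mem_Icc_right (v := fun _ => F) (s := fun _ => K) (K := C)
    (fun _ _ => hC) (hz _ h₁) (hz' _ h₁)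
    (fun s hs => Or.inl (mem_image_of_mem _ ⟨hs.1, hs.2.le⟩)) (hz _ h₂) (hz' _ h₂)
    (fun s hs => Or.inr (mem_image_of_mem _ ⟨hs.1, hs.2.le⟩)) (Prod.ext h0 h0')
  exact fun s hs => congrArg Prod.fst (hEq hs)

end IsGeodesic

/-! ### Rigidity: a canonical deformation is determined by its frame and connection. -/

namespace Deformation

variable {D D' : Deformation X T}

/-- Deformations with the same frame and the same second derivatives at the origin have the same
geodesics; a canonical one follows the canonical curves of the other one. -/
lemma IsCanonical.mem_params_of_canonicalCurve (hD : D.IsCanonical)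
    (hk : ∀ x ∈ X, D.k x = D'.k x) (hB : ∀ x ∈ X, D.hess x = D'.hess x) {c : ℝ → E}
    (hc : D'.IsCanonicalCurve c) :
    D'.vel c 0 ∈ D.params (c 0) ∧ D.f (c 0) (D'.vel c 0) = c 1 := by
  set x := c 0 with hx0
  set t := D'.vel c 0 with ht
  have hx : x ∈ X := hc.maps 0 (by simp)
  have hgeo : IsGeodesic X D.Gam 0 1 c := by
    refine ⟨hc.smooth, hc.maps, fun s hs => ?_⟩
    rw [D.Gam_eq, hk _ (hc.maps s hs), hB _ (hc.maps s hs)]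
    exact hc.isGeodesic.equation s hs
  -- As long as σt is a parameter for `D`, the canonical curve of `D` with initial velocity σt and
  -- the slowed-down curve s ↦ c(σs) are geodesics of the same connection with the same initial
  -- data, so they end at the same point.
  have hf : ∀ σ ∈ Icc (0 : ℝ) 1, σ • t ∈ D.params x → D.f x (σ • t) = c σ := by
    intro σ hσ hm
    rcases hσ.1.eq_or_lt with rfl | hpos
    · rw [zero_smul, D.f_zero hx]
    obtain ⟨c₁, hc₁, h0, hv⟩ := hD.exists_curve hx hm
    have hgeo' : IsGeodesic X D.Gam 0 1 (fun s => c (σ * s)) :=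
      hgeo.comp_mul (fun x v => D.Gam_smul x v σ) hpos one_pos (by simpa using hσ.2)
    have heq := IsGeodesic.eqOn
      (fun y hy v => (D.contDiffAt_Gam hy v).of_le (by simp))
      one_pos hc₁.isGeodesic hgeo' (by simp [h0, hx0]) (by
        rw [derivWithin_comp_mul hσ.1 one_pos (by simpa using hσ.2)
          (hc.smooth.differentiableOn (by simp)) (by simp), mul_zero,
          hc₁.derivWithin_eq (by simp), hv, hc.derivWithin_eq (by simp), h0, hk x hx,
          ← hx0, ← ht, map_smul])
    have hp := hc₁.point 1 (by simp)
    rw [one_smul, h0, hv] at hp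
    rw [hp]
    simpa using heq (right_mem_Icc.2 zero_le_one)
  -- Continuous induction on σ. The condition is open because the parameters form an open set. It is
  -- closed because, by `hf`, it is equivalent to the equation H_x(c(σ) − x) = σt, which makes sense
  -- on all of [0, 1] and whose two sides are continuous.
  have key : Icc (0 : ℝ) 1 ⊆ {σ | σ ∈ Icc (0 : ℝ) 1 ∧ σ • t ∈ D.params x} := by
    refine IsClosed.Icc_subset_of_forall_exists_gt ?_ ?_ ?_
    · have hset : {σ | σ ∈ Icc (0 : ℝ) 1 ∧ σ • t ∈ D.params x} ∩ Icc 0 1 =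
          Icc (0 : ℝ) 1 ∩ (fun σ => D.H x (c σ - x) - σ • t) ⁻¹' {0} := by
        ext σ
        simp only [mem_inter_iff, mem_ofPred_eq, mem_preimage, mem_singleton_iff, sub_eq_zero]
        constructor
        · rintro ⟨⟨hσ, hm⟩, -⟩
          exact ⟨hσ, by rw [← hf σ hσ hm, D.H_f_sub hx hm]⟩
        · rintro ⟨hσ, he⟩
          exact ⟨⟨hσ, he ▸ D.H_sub_mem_params (hc.maps σ hσ)⟩, hσ⟩
      rw [hset]
      refine ContinuousOn.preimage_isClosed_of_isClosed ?_ isClosed_Icc isClosed_singleton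
      refine ContinuousOn.sub (fun σ hσ => ?_) (by fun_prop)
      exact ((D.contDiffAt_H hx (by simpa using hc.maps σ hσ)).continuousAt).comp_continuousWithinAt
        (f := fun σ => c σ - x) ((hc.smooth.continuousOn σ hσ).sub continuousWithinAt_const)
    · exact ⟨by simp, by simpa using D.zero_mem_params hx⟩
    · rintro σ ⟨⟨hσ, hm⟩, hσ'⟩ y hy
      have hev : ∀ᶠ u in 𝓝[>] σ, u • t ∈ D.params x :=
        nhdsWithin_le_nhds ((D.isOpen_params hx).preimage
          (continuous_id.smul continuous_const) |>.mem_nhds hm)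
      have hlt : σ < min y 1 := lt_min hy hσ'.2
      obtain ⟨u, hu, hu'⟩ := (hev.and (Ioc_mem_nhdsGT hlt)).exists
      exact ⟨u, ⟨⟨hσ.1.trans hu'.1.le, hu'.2.trans (min_le_right _ _)⟩, hu⟩,
        hu'.1, hu'.2.trans (min_le_left _ _)⟩
  have h1 := (key (right_mem_Icc.2 zero_le_one)).2
  have h2 := hf 1 (by simp) h1
  rw [one_smul] at h1 h2
  exact ⟨h1, h2⟩

/-- Canonical deformations with the same frame and the same connection coincide. -/
lemma IsCanonical.H_eq (hD : D.IsCanonical) (hD' : D'.IsCanonical)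
    (hk : ∀ x ∈ X, D.k x = D'.k x) (hB : ∀ x ∈ X, D.hess x = D'.hess x) {x y : E}
    (hx : x ∈ X) (hy : y ∈ X) : D.H x (y - x) = D'.H x (y - x) := by
  -- The canonical curve of `D'` from x to y has initial velocity t = D'.H_x(y − x); since `D` also
  -- sends t to y, its own parameter for y is t.
  have ht := D'.H_sub_mem_params (x := x) hy
  obtain ⟨c, hc, rfl, h1⟩ := hD' x hx y hy
  have hv := hc.vel_zero_eq ht (by rw [D'.f_H_sub hx hy, h1])
  obtain ⟨hm, hf⟩ := hD.mem_params_of_canonicalCurve hk hB hc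
  rw [hv, h1] at hf
  rw [hv] at hm
  have := D.H_f_sub hx hm
  rwa [hf] at this

lemma φ_eq (D : Deformation X T) (x : E) (t t' : T) :
    D.φ x t t' = D.H x (D.f (D.f x t) t' - x) := by
  rw [φ, f, f]
  congr 1
  abel

/-! ### Consequences of the coincidence of two deformations. -/

section Coincidence

variable (hH : ∀ x ∈ X, ∀ y ∈ X, D.H x (y - x) = D'.H x (y - x))
include hH

/-- The hypothesis `hH` controls `H` only for displacements inside `X`; outside, the values are
arbitrary. Accordingly the derived objects are compared at points of `X` and at parameters, or
through derivatives taken at interior points. -/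
lemma params_congr {x : E} (hx : x ∈ X) : D.params x = D'.params x := by
  refine image_congr fun s hs => ?_
  simpa using hH x hx (x + s) hs

lemma f_congr {x : E} (hx : x ∈ X) {t : T} (ht : t ∈ D.params x) : D.f x t = D'.f x t := by
  have h1 := D.H_f_sub hx ht
  have hy := D.f_mem hx ht
  rw [hH x hx _ hy] at h1
  conv_rhs => rw [← h1, D'.f_H_sub hx hy]

lemma φ_congr {x : E} (hx : x ∈ X) {t t' : T} (ht : t ∈ D.params x)
    (ht' : t' ∈ D.params (D.f x t)) : D.φ x t t' = D'.φ x t t' := by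
  have hy := D.f_mem hx ht
  rw [φ_eq, φ_eq, hH x hx _ (D.f_mem hy ht'), f_congr hH hy ht', f_congr hH hx ht]

lemma h_congr {x : E} (hx : x ∈ X) : D.h x = D'.h x := by
  refine Filter.EventuallyEq.fderiv_eq ?_
  filter_upwards [(X.isOpen.preimage (continuous_const.add continuous_id)).mem_nhds
    (add_zero_mem hx)] with s hs
  simpa using hH x hx (x + s) hs

lemma lam_congr {x : E} (hx : x ∈ X) {t : T} (ht : t ∈ D.params x) :
    D.lam x t = D'.lam x t := by
  refine Filter.EventuallyEq.fderiv_eq ?_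
  filter_upwards [(D.isOpen_params (D.f_mem hx ht)).mem_nhds
    (D.zero_mem_params (D.f_mem hx ht))] with t' ht'
  exact φ_congr hH hx ht ht'

lemma vel_congr {c : ℝ → E} {s : ℝ} (hs : c s ∈ X) : D.vel c s = D'.vel c s := by
  rw [vel, vel, h_congr hH hs]

lemma IsCanonicalCurve.congr {c : ℝ → E} (hc : D.IsCanonicalCurve c) :
    D'.IsCanonicalCurve c := by
  have h0 : (0 : ℝ) ∈ Icc (0 : ℝ) 1 := by simp
  have hv : ∀ s ∈ Icc (0 : ℝ) 1, D'.vel c s = D.vel c s := fun s hs =>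
    (vel_congr hH (hc.maps s hs)).symm
  have hp : ∀ s ∈ Icc (0 : ℝ) 1, D'.params (c s) = D.params (c s) := fun s hs =>
    (params_congr hH (hc.maps s hs)).symm
  refine ⟨hc.smooth, hc.maps, fun s hs => ?_, fun s hs => ?_, fun s s' hs hs' => ?_,
    fun s s' hs hs' => ?_⟩
  · rw [hv 0 h0, hp 0 h0]
    exact hc.mem s hs
  · rw [hv 0 h0, ← f_congr hH (hc.maps 0 h0) (hc.mem s hs)]
    exact hc.point s hs
  · rw [hv s hs, hp s hs]
    exact hc.mem' s s' hs hs'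
  · rw [hv 0 h0, hv s hs, ← φ_congr hH (hc.maps 0 h0) (hc.mem s hs)]
    · exact hc.comp s s' hs hs'
    · rw [hc.point s hs]
      exact hc.mem' s s' hs hs'

end Coincidence

end Deformation

/-! ### The deformed groups as copies of the gauge groups. -/

namespace Gauge

/-- The gauge translations as elements of the generalized gauge group. -/
noncomputable def ofTrans (X : Opens E) (T : Type*) [NormedAddCommGroup T]
    [InnerProductSpace ℝ T] [FiniteDimensional ℝ T] : Trans X →* Gauge X T where
  toFun a := { toTrans := a, rot := fun _ => 1, rot_smooth := contDiffOn_const, rot_off := fun _ _ => rfl }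
  map_one' := rfl
  map_mul' a b := by
    refine ext_rot rfl fun x hx hx' => ?_
    rw [mul_rot _ _ hx']
    exact (mul_one 1).symm

lemma ofTrans_inv (a : Trans X) : ofTrans X T a⁻¹ = (ofTrans X T a)⁻¹ := by
  refine ext_rot rfl ?_
  rintro _ ⟨x, hx, rfl⟩ -
  exact (inv_one.symm.trans (inv_rot (ofTrans X T a) hx).symm : (1 : T ≃ₗᵢ[ℝ] T) = _)

/-- A translation by a constant displacement, with a constant rotation. -/
noncomputable def const (X : Opens E) (v : E) (r : T ≃ₗᵢ[ℝ] T) : Gauge X T where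
  dom := {x | x ∈ X ∧ x + v ∈ X}
  disp := {x | x ∈ X ∧ x + v ∈ X}.indicator fun _ => v
  isOpen_dom := X.isOpen.inter (X.isOpen.preimage (continuous_id.add continuous_const))
  dom_subset _ hx := hx.1
  smooth := contDiffOn_const.congr fun x hx => indicator_of_mem hx _
  maps x hx := by rw [indicator_of_mem hx]; exact hx.2
  inj x hx y hy h := by
    simp only [indicator_of_mem hx, indicator_of_mem hy] at h
    exact add_right_cancel h
  det_ne x hx := by
    have : {x | x ∈ X ∧ x + v ∈ X}.indicator (fun _ => v) =ᶠ[𝓝 x] fun _ => v := by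
      filter_upwards [(X.isOpen.inter (X.isOpen.preimage
        (continuous_id.add continuous_const))).mem_nhds hx] with y hy
      exact indicator_of_mem hy _
    rw [this.fderiv_eq]
    simp [ContinuousLinearMap.det]
  disp_off _ hx := indicator_of_notMem hx _
  rot := {x | x ∈ X ∧ x + v ∈ X}.mulIndicator fun _ => r
  rot_smooth := contDiffOn_const.congr fun x hx =>
    congrArg rotCLM (mulIndicator_of_mem (s := {x | x ∈ X ∧ x + v ∈ X}) hx fun _ => r)
  rot_off _ hx := mulIndicator_of_notMem hx _

end Gauge

namespace DefTrans

variable {D : Deformation X T}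

lemma equiv_mul (a b : Trans X) : equiv D (a * b) = equiv D a * equiv D b := by
  change _ = equiv D ((equiv D).symm _ * (equiv D).symm _)
  simp

lemma equiv_inv (a : Trans X) : equiv D a⁻¹ = (equiv D a)⁻¹ := by
  change _ = equiv D ((equiv D).symm _)⁻¹
  simp

/-- The deformation of the elements, as an isomorphism. -/
noncomputable def mulEquiv (D : Deformation X T) : Trans X ≃* DefTrans D :=
  ⟨equiv D, equiv_mul⟩

lemma mulEquiv_inv (a : Trans X) : mulEquiv D a⁻¹ = (mulEquiv D a)⁻¹ := equiv_inv a

lemma mulEquiv_dom (a : Trans X) : (mulEquiv D a).dom = a.dom := rfl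

lemma mulEquiv_par (a : Trans X) :
    (mulEquiv D a).par = a.dom.indicator fun x => D.H x (a.disp x) := rfl

lemma mulEquiv_act (a : Trans X) {x : E} (hx : x ∈ a.dom) : (mulEquiv D a).act x = a.act x :=
  act_ofTrans a hx

end DefTrans

namespace DefGauge

variable {P : GaugeDeformation X T}

lemma equiv_mul (a b : Gauge X T) : equiv P (a * b) = equiv P a * equiv P b := by
  change _ = equiv P ((equiv P).symm _ * (equiv P).symm _)
  simp

lemma equiv_inv (a : Gauge X T) : equiv P a⁻¹ = (equiv P a)⁻¹ := by
  change _ = equiv P ((equiv P).symm _)⁻¹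
  simp

/-- The deformation of the elements, as an isomorphism. -/
noncomputable def mulEquiv (P : GaugeDeformation X T) : Gauge X T ≃* DefGauge P :=
  ⟨equiv P, equiv_mul⟩

lemma mulEquiv_inv (a : Gauge X T) : mulEquiv P a⁻¹ = (mulEquiv P a)⁻¹ := equiv_inv a

lemma mulEquiv_dom (a : Gauge X T) : (mulEquiv P a).dom = a.dom := rfl

lemma mulEquiv_par (a : Gauge X T) :
    (mulEquiv P a).par = a.dom.indicator fun x => P.H x (a.disp x) := rfl

lemma mulEquiv_rot (a : Gauge X T) :
    (mulEquiv P a).rot =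
      a.dom.mulIndicator fun x => a.rot x * (P.π x (P.H x (a.disp x)))⁻¹ := rfl

lemma mulEquiv_act (a : Gauge X T) {x : E} (hx : x ∈ a.dom) : (mulEquiv P a).act x = a.act x :=
  act_ofGauge a hx

/-- The factor π(t)⁻¹ in the deformed rotation cancels against the π(t) in `L`, leaving the
undeformed rotation. This makes `L` multiplicative and hence gives an action on tangent vectors. -/
lemma mulEquiv_L (a : Gauge X T) {x : E} (hx : x ∈ a.dom) : (mulEquiv P a).L x = a.rot x := by
  rw [L, mulEquiv_par, mulEquiv_rot, mulIndicator_of_mem hx, indicator_of_mem hx,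
    inv_mul_cancel_right]

lemma act_mem (a : DefGauge P) {x : E} (hx : x ∈ a.dom) : a.act x ∈ X := by
  obtain ⟨a, rfl⟩ := (mulEquiv P).surjective a
  rw [mulEquiv_act a hx]
  exact a.act_mem hx

lemma dom_subset (a : DefGauge P) : a.dom ⊆ X := by
  obtain ⟨a, rfl⟩ := (mulEquiv P).surjective a
  exact a.dom_subset

lemma mul_act (a b : DefGauge P) {x : E} (hx : x ∈ (a * b).dom) :
    (a * b).act x = b.act (a.act x) := by
  obtain ⟨hxa, hxb⟩ := mem_mul.1 hx
  obtain ⟨a, rfl⟩ := (mulEquiv P).surjective a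
  obtain ⟨b, rfl⟩ := (mulEquiv P).surjective b
  rw [← map_mul] at hx ⊢
  rw [mulEquiv_act a hxa] at hxb ⊢
  rw [mulEquiv_act _ hx, mulEquiv_act _ hxb]
  exact Trans.mul_act _ _ hx

lemma mul_L (a b : DefGauge P) {x : E} (hx : x ∈ (a * b).dom) :
    (a * b).L x = a.L x * b.L (a.act x) := by
  obtain ⟨hxa, hxb⟩ := mem_mul.1 hx
  obtain ⟨a, rfl⟩ := (mulEquiv P).surjective a
  obtain ⟨b, rfl⟩ := (mulEquiv P).surjective b
  rw [← map_mul] at hx ⊢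
  rw [mulEquiv_act a hxa] at hxb ⊢
  rw [mulEquiv_L _ hx, mulEquiv_L _ hxa, mulEquiv_L _ hxb]
  exact Gauge.mul_rot _ _ hx

/-- At the intermediate point `k` followed by `h` cancels, so the claim reduces to the
multiplicativity of `L`. -/
lemma mul_tangentAct (a b : DefGauge P) {x : E} (hx : x ∈ (a * b).dom) (v : E) :
    (a * b).tangentAct x v = a.tangentAct x (b.tangentAct (a.act x) v) := by
  rw [tangentAct, tangentAct, tangentAct, mul_act a b hx, mul_L a b hx,
    P.h_k (a.act_mem (mem_mul.1 hx).1)]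
  rfl

lemma one_act {x : E} (hx : x ∈ X) : (1 : DefGauge P).act x = x := by
  rw [← map_one (mulEquiv P), mulEquiv_act _ hx]
  exact Trans.one_act x

lemma one_tangentAct {x : E} (hx : x ∈ X) (v : E) : (1 : DefGauge P).tangentAct x v = v := by
  rw [tangentAct, one_act hx, ← map_one (mulEquiv P), mulEquiv_L _ hx, Gauge.one_rot]
  exact P.k_h hx v

lemma metric_tangentAct (a : DefGauge P) {x : E} (hx : x ∈ a.dom) (v w : E) :
    P.metric x (a.tangentAct x v) (a.tangentAct x w) = P.metric (a.act x) v w := by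
  rw [tangentAct, tangentAct, P.metric_k (a.dom_subset hx), LinearIsometryEquiv.inner_map_map]
  rfl

lemma vecLength_tangentAct (a : DefGauge P) {x : E} (hx : x ∈ a.dom) (v : E) :
    vecLength P.metric x (a.tangentAct x v) = vecLength P.metric (a.act x) v := by
  rw [vecLength, vecLength, metric_tangentAct a hx]

lemma vecAngle_tangentAct (a : DefGauge P) {x : E} (hx : x ∈ a.dom) (v w : E) :
    vecAngle P.metric x (a.tangentAct x v) (a.tangentAct x w) =
      vecAngle P.metric (a.act x) v w := by
  rw [vecAngle, vecAngle, metric_tangentAct a hx, vecLength_tangentAct a hx,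
    vecLength_tangentAct a hx]

end DefGauge

/-- Families of vectors of a Euclidean space with the same Gram matrix are congruent. -/
lemma exists_isometry_of_inner_eq {ι : Type*} (a b : ι → T)
    (h : ∀ i j, (inner ℝ (a i) (a j) : ℝ) = inner ℝ (b i) (b j)) :
    ∃ r : T ≃ₗᵢ[ℝ] T, ∀ i, r (a i) = b i := by
  let A := Finsupp.linearCombination ℝ a
  let B := Finsupp.linearCombination ℝ b
  have hin : ∀ c, (inner ℝ (A c) (A c) : ℝ) = inner ℝ (B c) (B c) := by
    intro c
    simp only [A, B, Finsupp.linearCombination_apply, Finsupp.sum, sum_inner, inner_sum,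
      real_inner_smul_left, real_inner_smul_right, h]
  have hnorm : ∀ c, ‖A c‖ = ‖B c‖ := fun c => by
    rw [norm_eq_sqrt_real_inner, norm_eq_sqrt_real_inner, hin]
  -- Equal Gram matrices give ‖A c‖ = ‖B c‖ for every formal combination c, so `B` factors through
  -- the range of `A` as a linear isometry.
  have hker : A.ker ≤ B.ker := fun c hc => by
    rw [LinearMap.mem_ker, ← norm_eq_zero] at hc ⊢
    rw [← hnorm, hc]
  let L₀ : A.range →ₗ[ℝ] T :=
    (A.ker.liftQ B hker).comp A.quotKerEquivRange.symm.toLinearMap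
  have hL₀ : ∀ c, L₀ ⟨A c, c, rfl⟩ = B c := by
    intro c
    have : A.quotKerEquivRange.symm ⟨A c, c, rfl⟩ = A.ker.mkQ c :=
      (LinearEquiv.symm_apply_eq _).2 rfl
    change A.ker.liftQ B hker (A.quotKerEquivRange.symm ⟨A c, c, rfl⟩) = B c
    rw [this]
    rfl
  let L₁ : A.range →ₗᵢ[ℝ] T := ⟨L₀, by
    rintro ⟨_, c, rfl⟩
    rw [hL₀]
    exact (hnorm c).symm⟩
  -- An isometry defined on a subspace of the finite-dimensional space `T` extends to all of `T`,
  -- and an isometry from `T` to itself is bijective by dimension.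
  refine ⟨L₁.extend.toLinearIsometryEquiv rfl, fun i => ?_⟩
  have ha : A (Finsupp.single i 1) = a i := by simp [A]
  have hb : B (Finsupp.single i 1) = b i := by simp [B]
  have := L₁.extend_apply ⟨A (Finsupp.single i 1), _, rfl⟩
  rw [LinearIsometry.coe_toLinearIsometryEquiv]
  calc L₁.extend (a i) = L₁.extend (A (Finsupp.single i 1)) := by rw [ha]
    _ = L₁ ⟨A (Finsupp.single i 1), _, rfl⟩ := this
    _ = B (Finsupp.single i 1) := hL₀ _
    _ = b i := hb

/-! ### Congruence of figures, projection onto translations, kernel, and embedding. -/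

namespace DefGauge

variable {P : GaugeDeformation X T}

/-- Congruent families of tangent vectors can be superimposed. -/
lemma exists_tangentAct_iff {x x' : E} (hx : x ∈ X) (hx' : x' ∈ X) {ι : Type*} (v w : ι → E) :
    (∃ ϑ : DefGauge P, x ∈ ϑ.dom ∧ ϑ.act x = x' ∧ ∀ i, ϑ.tangentAct x (v i) = w i) ↔
      ∀ i j, P.metric x' (v i) (v j) = P.metric x (w i) (w j) := by
  constructor
  · rintro ⟨ϑ, hϑ, rfl, h⟩ i j
    rw [← h i, ← h j, ϑ.metric_tangentAct hϑ]
  · intro h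
    obtain ⟨r, hr⟩ := exists_isometry_of_inner_eq (fun i => P.h x' (v i))
      (fun i => P.h x (w i)) h
    -- A single point and a single isometry are prescribed, so constant fields suffice: the
    -- displacement takes x to x', and the isometry matches the two families in the frames.
    have hm : x ∈ (Gauge.const X (x' - x) r).dom := ⟨hx, by simpa using hx'⟩
    have hact : (mulEquiv P (Gauge.const X (x' - x) r)).act x = x' := by
      rw [mulEquiv_act _ hm, Trans.act]
      exact (congrArg (x + ·) (indicator_of_mem hm _)).trans (add_sub_cancel _ _)
    refine ⟨mulEquiv P (Gauge.const X (x' - x) r), hm, hact, fun i => ?_⟩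
    have hrot : (Gauge.const X (x' - x) r).rot x = r :=
      mulIndicator_of_mem (s := {y | y ∈ X ∧ y + (x' - x) ∈ X}) hm fun _ => r
    rw [tangentAct, hact, mulEquiv_L _ hm, hrot, hr]
    exact P.k_h hx _

variable {D : Deformation X T} (P)

/-- The projection `(t, r) ↦ t`, for a deformation of translations that coincides with that of
the group. -/
noncomputable def proj (D : Deformation X T) : DefGauge P →* DefTrans D :=
  ((DefTrans.mulEquiv D).toMonoidHom.comp ⟨⟨Gauge.toTrans, rfl⟩, fun _ _ => rfl⟩).comp
    (mulEquiv P).symm.toMonoidHom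

lemma proj_mulEquiv (a : Gauge X T) : proj P D (mulEquiv P a) = DefTrans.mulEquiv D a.toTrans :=
  congrArg (fun b : Gauge X T => DefTrans.mulEquiv D b.toTrans) ((mulEquiv P).symm_apply_apply a)

lemma proj_surjective : Function.Surjective (proj P D) := fun a => by
  obtain ⟨a, rfl⟩ := (DefTrans.mulEquiv D).surjective a
  exact ⟨mulEquiv P (Gauge.ofTrans X T a), proj_mulEquiv P _⟩

lemma proj_inv (ϑ : DefGauge P) : proj P D ϑ⁻¹ = (proj P D ϑ)⁻¹ := by
  obtain ⟨a, rfl⟩ := (mulEquiv P).surjective ϑ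
  rw [← mulEquiv_inv, proj_mulEquiv, proj_mulEquiv, ← DefTrans.mulEquiv_inv]
  rfl

lemma proj_dom (ϑ : DefGauge P) : (proj P D ϑ).dom = ϑ.dom := by
  obtain ⟨a, rfl⟩ := (mulEquiv P).surjective ϑ
  rw [proj_mulEquiv]
  rfl

lemma proj_act (ϑ : DefGauge P) {x : E} (hx : x ∈ ϑ.dom) : (proj P D ϑ).act x = ϑ.act x := by
  obtain ⟨a, rfl⟩ := (mulEquiv P).surjective ϑ
  rw [proj_mulEquiv, DefTrans.mulEquiv_act _ hx, mulEquiv_act _ hx]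

/-- The projection is defined on undeformed elements, by forgetting the rotation. That it is (t, r)
↦ t on the parameters is the coincidence of the two deformations. -/
lemma proj_par (hH : ∀ x ∈ X, ∀ y ∈ X, P.H x (y - x) = D.H x (y - x)) (ϑ : DefGauge P) :
    (proj P D ϑ).par = ϑ.par := by
  obtain ⟨a, rfl⟩ := (mulEquiv P).surjective ϑ
  rw [proj_mulEquiv, DefTrans.mulEquiv_par, mulEquiv_par]
  refine indicator_congr fun x hx => ?_
  simpa using (hH x (a.dom_subset hx) _ (a.maps x hx)).symm

/-- The inclusion of the gauge rotations. -/
noncomputable def incl : Gauge.Rotations X T →* DefGauge P :=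
  (mulEquiv P).toMonoidHom.comp (Gauge.Rotations X T).subtype

lemma incl_apply (ρ : Gauge.Rotations X T) : incl P ρ = mulEquiv P ρ.1 := rfl

lemma incl_injective : Function.Injective (incl P) :=
  (mulEquiv P).injective.comp Subtype.val_injective

lemma incl_par (ρ : Gauge.Rotations X T) (x : E) : (incl P ρ).par x = 0 := by
  rw [incl_apply, mulEquiv_par]
  by_cases hx : x ∈ ρ.1.dom
  · rw [indicator_of_mem hx, ρ.2 x, P.map_zero x (ρ.1.dom_subset hx)]
  · exact indicator_of_notMem hx _

lemma incl_rot (ρ : Gauge.Rotations X T) : (incl P ρ).rot = ρ.1.rot := by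
  rw [incl_apply, mulEquiv_rot]
  ext1 x
  by_cases hx : x ∈ ρ.1.dom
  · rw [mulIndicator_of_mem hx, ρ.2 x, P.map_zero x (ρ.1.dom_subset hx),
      P.π_zero x (ρ.1.dom_subset hx), inv_one, mul_one]
  · rw [mulIndicator_of_notMem hx, ρ.1.rot_off x hx]

/-- The deformation does not change the action on points, so a trivial action means that the
undeformed displacement vanishes. -/
lemma mem_range_incl (ϑ : DefGauge P) :
    ϑ ∈ Set.range (incl P) ↔ ∀ x ∈ ϑ.dom, ϑ.act x = x := by
  constructor
  · rintro ⟨ρ, rfl⟩ x hx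
    rw [incl_apply, mulEquiv_act ρ.1 hx, Trans.act, ρ.2 x, add_zero]
  · intro h
    obtain ⟨a, rfl⟩ := (mulEquiv P).surjective ϑ
    refine ⟨⟨a, fun x => ?_⟩, rfl⟩
    by_cases hx : x ∈ a.dom
    · have := h x hx
      rw [mulEquiv_act _ hx] at this
      exact add_eq_left.1 this
    · exact a.disp_off x hx

/-- The embedding `t ↦ (t, π(t)⁻¹)` of the translations. -/
noncomputable def emb (D : Deformation X T) : DefTrans D →* DefGauge P :=
  ((mulEquiv P).toMonoidHom.comp (Gauge.ofTrans X T)).comp (DefTrans.mulEquiv D).symm.toMonoidHom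

lemma emb_mulEquiv (a : Trans X) :
    emb P D (DefTrans.mulEquiv D a) = mulEquiv P (Gauge.ofTrans X T a) :=
  congrArg (fun b => mulEquiv P (Gauge.ofTrans X T b)) ((DefTrans.mulEquiv D).symm_apply_apply a)

lemma emb_injective : Function.Injective (emb P D) :=
  ((mulEquiv P).injective.comp fun _ _ h => congrArg Gauge.toTrans h).comp
    (DefTrans.mulEquiv D).symm.injective

lemma emb_inv (a : DefTrans D) : emb P D a⁻¹ = (emb P D a)⁻¹ := by
  obtain ⟨a, rfl⟩ := (DefTrans.mulEquiv D).surjective a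
  rw [← DefTrans.mulEquiv_inv, emb_mulEquiv, emb_mulEquiv, Gauge.ofTrans_inv, mulEquiv_inv]

lemma emb_dom (a : DefTrans D) : (emb P D a).dom = a.dom := by
  obtain ⟨a, rfl⟩ := (DefTrans.mulEquiv D).surjective a
  rw [emb_mulEquiv]
  rfl

lemma emb_L (a : DefTrans D) {x : E} (hx : x ∈ a.dom) : (emb P D a).L x = 1 := by
  obtain ⟨a, rfl⟩ := (DefTrans.mulEquiv D).surjective a
  rw [emb_mulEquiv, mulEquiv_L (Gauge.ofTrans X T a) hx]
  rfl

lemma emb_act (a : DefTrans D) {x : E} (hx : x ∈ a.dom) : (emb P D a).act x = a.act x := by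
  obtain ⟨a, rfl⟩ := (DefTrans.mulEquiv D).surjective a
  rw [emb_mulEquiv, mulEquiv_act (Gauge.ofTrans X T a) hx, DefTrans.mulEquiv_act a hx]
  rfl

lemma emb_par (hH : ∀ x ∈ X, ∀ y ∈ X, P.H x (y - x) = D.H x (y - x)) (a : DefTrans D) :
    (emb P D a).par = a.par := by
  obtain ⟨a, rfl⟩ := (DefTrans.mulEquiv D).surjective a
  rw [emb_mulEquiv, mulEquiv_par, DefTrans.mulEquiv_par]
  refine indicator_congr fun x hx => ?_
  have := hH x (a.dom_subset hx) _ (a.maps x hx)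
  rwa [add_sub_cancel_left] at this

end DefGauge

lemma IsGeodesic.congr {Γ : E → E → E → E} {a b : ℝ} {c₁ c₂ : ℝ → E}
    (hc : IsGeodesic X Γ a b c₁) (h : EqOn c₂ c₁ (Icc a b)) : IsGeodesic X Γ a b c₂ := by
  have hd : EqOn (derivWithin c₂ (Icc a b)) (derivWithin c₁ (Icc a b)) (Icc a b) :=
    fun s hs => derivWithin_congr h (h hs)
  refine ⟨hc.smooth.congr h, fun s hs => h hs ▸ hc.maps s hs, fun s hs => ?_⟩
  rw [derivWithin_congr hd (hd hs), hd hs, h hs, hc.equation s hs]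

/-! ### Canonical curves in the frame, and lengths of geodesics. -/

namespace Deformation

variable {D : Deformation X T}

lemma vecLength_metric (D : Deformation X T) (x v : E) : vecLength D.metric x v = ‖D.h x v‖ :=
  (norm_eq_sqrt_real_inner _).symm

namespace IsCanonicalCurve

variable {c : ℝ → E}

lemma f_vel (hc : D.IsCanonicalCurve c) {s u : ℝ} (hs : s ∈ Icc (0 : ℝ) 1)
    (hu : u ∈ Icc (0 : ℝ) 1) : D.f (c s) ((u - s) • D.vel c s) = c u := by
  rw [← hc.H_sub hs hu, D.f_H_sub (hc.maps s hs) (hc.maps u hu)]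

/-- The transport along a canonical curve takes its velocity to its velocity. -/
lemma lam_vel (hc : D.IsCanonicalCurve c) :
    D.lam (c 0) (D.vel c 0) (D.vel c 1) = D.vel c 0 := by
  have h0 : (0 : ℝ) ∈ Icc (0 : ℝ) 1 := by simp
  have h1 : (1 : ℝ) ∈ Icc (0 : ℝ) 1 := by simp
  have hm := hc.mem 1 h1
  have hp := hc.point 1 h1
  rw [one_smul] at hm hp
  have hK : D.K (c 0) (D.vel c 0) = c 1 - c 0 := by rw [← hp, f, add_sub_cancel_left]
  rw [D.lam_eq (hc.maps 0 h0) hm, hK, hp, ContinuousLinearMap.comp_apply, ← hc.derivWithin_eq h1,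
    hc.fderiv_H_derivWithin h0 h1]

/-- The equation of geodesics in the frame. -/
lemma hasDerivWithinAt_vel (hc : D.IsCanonicalCurve c) {s : ℝ} (hs : s ∈ Icc (0 : ℝ) 1) :
    HasDerivWithinAt (D.vel c) (-D.gamma (c s) (D.vel c s) (D.vel c s)) (Icc 0 1) s := by
  have hX := hc.maps s hs
  have hh := ((D.contDiffAt_h hX).differentiableAt (by simp)).hasFDerivAt
  refine ((hh.comp_hasDerivWithinAt s (hc.hasDerivWithinAt hs)).clm_apply
    (hc.hasDerivWithinAt_derivWithin hs)).congr_deriv ?_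
  -- Substituting c'' = −Γ(c', c') in (h c')' leaves (∂_{c'} h)c' − ∂²H(0)(c', c'), which is −γ(τ,
  -- τ) by `gamma_h`.
  have he := hc.isGeodesic.equation s hs
  rw [eq_neg_of_add_eq_zero_left he, Gam_eq, vel, D.gamma_h hX]
  simp only [Function.comp_apply, _root_.map_neg, D.h_k hX]
  abel

lemma f_smul_eqOn (hc : D.IsCanonicalCurve c) {S : ℝ} (hS : 0 < S) {τ : T}
    (hv : D.vel c 0 = S • τ) :
    EqOn (fun s => D.f (c 0) (s • τ)) (fun s => c (S⁻¹ * s)) (Icc 0 S) := by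
  intro s hs
  have := hc.point (S⁻¹ * s) ⟨by have := hs.1; positivity, by
    rw [inv_mul_le_one₀ hS]; exact hs.2⟩
  rw [hv, smul_smul, mul_right_comm, inv_mul_cancel₀ hS.ne', one_mul] at this
  exact this

end IsCanonicalCurve

/-- Canonicity makes the parameter sets star-shaped about 0: the canonical curve with initial
velocity Sτ has the parameter sτ at time s/S. -/
lemma IsCanonical.smul_mem_params (hD : D.IsCanonical) {x : E} (hx : x ∈ X) {τ : T} {S : ℝ}
    (hS : S • τ ∈ D.params x) {s : ℝ} (hs : s ∈ Icc 0 S) : s • τ ∈ D.params x := by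
  rcases hs.1.eq_or_lt with rfl | hs0
  · simpa using D.zero_mem_params hx
  have hS0 : 0 < S := hs0.trans_le hs.2
  obtain ⟨c, hc, rfl, hv⟩ := hD.exists_curve hx hS
  have := hc.mem (S⁻¹ * s) ⟨by positivity, by rw [inv_mul_le_one₀ hS0]; exact hs.2⟩
  rwa [hv, smul_smul, mul_right_comm, inv_mul_cancel₀ hS0.ne', one_mul] at this

lemma IsCanonical.isGeodesic_f (hD : D.IsCanonical) {x : E} (hx : x ∈ X) {τ : T} {S : ℝ}
    (hS0 : 0 < S) (hS : S • τ ∈ D.params x) :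
    IsGeodesic X D.Gam 0 S (fun s => D.f x (s • τ)) := by
  obtain ⟨c, hc, rfl, hv⟩ := hD.exists_curve hx hS
  exact (hc.isGeodesic.comp_mul (fun x v => D.Gam_smul x v S⁻¹) (inv_pos.2 hS0) hS0
    (inv_mul_cancel₀ hS0.ne').le).congr (hc.f_smul_eqOn hS0 hv)

/-- The metric length of the derivative of a canonical curve is the norm of its frame velocity,
which is constant for Riemannian translations. Slowing the curve by S turns the constant S‖τ‖ into
‖τ‖. -/
lemma IsRiemannianTranslations.curveLength_f (hD : D.IsRiemannianTranslations) {x : E}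
    (hx : x ∈ X) {τ : T} {S : ℝ} (hS0 : 0 ≤ S) (hS : S • τ ∈ D.params x) :
    curveLength D.metric 0 S (fun s => D.f x (s • τ)) = S * ‖τ‖ := by
  rcases hS0.eq_or_lt with rfl | hS0
  · simp [curveLength]
  obtain ⟨c, hc, rfl, hv⟩ := hD.canonical.exists_curve hx hS
  have heq := hc.f_smul_eqOn hS0 hv
  have hconst : ∀ s ∈ Icc 0 S, vecLength D.metric (D.f (c 0) (s • τ))
      (derivWithin (fun s => D.f (c 0) (s • τ)) (Icc 0 S) s) = ‖τ‖ := by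
    intro s hs
    have hs' : S⁻¹ * s ∈ Icc (0 : ℝ) 1 :=
      ⟨by have := hs.1; positivity, by rw [inv_mul_le_one₀ hS0]; exact hs.2⟩
    have hn : ‖D.vel c (S⁻¹ * s)‖ = S * ‖τ‖ := by
      rw [norm_eq_sqrt_real_inner, hD.length c hc _ hs', ← norm_eq_sqrt_real_inner, hv, norm_smul,
        Real.norm_of_nonneg hS0.le]
    have hp : D.f (c 0) (s • τ) = c (S⁻¹ * s) := heq hs
    rw [derivWithin_congr heq hp, derivWithin_comp_mul (inv_nonneg.2 hS0.le) hS0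
      (inv_mul_cancel₀ hS0.ne').le (hc.smooth.differentiableOn (by simp)) hs, hp,
      vecLength_metric, map_smul, norm_smul]
    change ‖S⁻¹‖ * ‖D.vel c (S⁻¹ * s)‖ = _
    rw [hn, norm_inv, Real.norm_of_nonneg hS0.le, inv_mul_cancel_left₀ hS0.ne']
  rw [curveLength, intervalIntegral.integral_congr (g := fun _ => ‖τ‖)
    (fun s hs => hconst s (by rwa [uIcc_of_le hS0.le] at hs))]
  simp

end Deformation

/-! ### Parallel transports and the scale moved along itself. -/

namespace GaugeDeformation

variable {P : GaugeDeformation X T}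

lemma contDiffAt_π {x : E} (hx : x ∈ X) {t : T} (ht : t ∈ P.params x) :
    ContDiffAt ℝ ∞ (fun t => rotCLM (P.π x t)) t := by
  have : ContDiffOn ℝ ∞ (fun t => rotCLM (P.π x t)) (P.params x) :=
    ContDiffOn.comp (g := fun p : E × T => rotCLM (P.π p.1 p.2)) (f := fun t : T => (x, t))
      P.π_smooth (by fun_prop) fun t ht => ⟨hx, ht⟩
  exact this.contDiffAt ((P.isOpen_params hx).mem_nhds ht)

lemma hasFDerivAt_π {x : E} (hx : x ∈ X) :
    HasFDerivAt (fun t => rotCLM (P.π x t)) (fderiv ℝ (fun t => rotCLM (P.π x t)) 0) 0 :=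
  ((contDiffAt_π hx (P.zero_mem_params hx)).differentiableAt (by simp)).hasFDerivAt

/-- Infinitesimal rotations are skew. -/
lemma fderiv_π_skew {x : E} (hx : x ∈ X) (t a b : T) :
    (inner ℝ (fderiv ℝ (fun t => rotCLM (P.π x t)) 0 t a) b : ℝ) +
      inner ℝ a (fderiv ℝ (fun t => rotCLM (P.π x t)) 0 t b) = 0 := by
  have hd := P.hasFDerivAt_π hx
  -- Both sides of ⟨π(t)a, π(t)b⟩ = ⟨a, b⟩ are differentiated at t = 0, where π is the identity.
  have h := ((hd.clm_apply (hasFDerivAt_const a (0 : T))).inner ℝ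
    (hd.clm_apply (hasFDerivAt_const b (0 : T)))).fderiv
  have hc : (fun t => (inner ℝ (rotCLM (P.π x t) a) (rotCLM (P.π x t) b) : ℝ)) =
      fun _ => inner ℝ a b := by
    ext t
    exact (P.π x t).inner_map_map a b
  have h0 : ∀ v, rotCLM (P.π x 0) v = v := fun v => by rw [P.π_zero x hx]; rfl
  rw [hc, fderiv_const_apply] at h
  have := DFunLike.congr_fun h t
  simp [h0] at this
  linarith

variable {D : Deformation X T}

lemma IsConsistent.gamma_skew (hP : P.IsConsistent D) {x : E} (hx : x ∈ X) (t a b : T) :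
    (inner ℝ (P.gamma x t a) b : ℝ) + inner ℝ a (P.gamma x t b) = 0 := by
  rw [hP.lam_transport x hx, ← hP.pi_transport x hx]
  exact P.fderiv_π_skew hx t a b

lemma IsConsistent.hess_eq (hP : P.IsConsistent D) {x : E} (hx : x ∈ X) :
    P.hess x = D.hess x :=
  P.hess_eq_of_gamma_eq hP.frame hP.lam_transport hx

lemma IsParallelTransports.isCanonical (hP : P.IsParallelTransports D) :
    P.toDeformation.IsCanonical := fun x hx x' hx' => by
  obtain ⟨c, hc, h0, h1, -⟩ := hP.canonical x hx x' hx'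
  exact ⟨c, hc, h0, h1⟩

lemma IsParallelTransports.H_eq (hP : P.IsParallelTransports D) (hD : D.IsCanonical) {x y : E}
    (hx : x ∈ X) (hy : y ∈ X) : P.H x (y - x) = D.H x (y - x) :=
  hP.isCanonical.H_eq hD hP.consistent.frame (fun _ h => hP.consistent.hess_eq h) hx hy

/-- Since `H` coincides for the two deformations, canonical curves of P are canonical for D with the
same velocities, so the constancy of length is inherited. -/
lemma IsParallelTransports.isRiemannianTranslations (hP : P.IsParallelTransports D)
    (hD : D.IsRiemannianTranslations) : P.toDeformation.IsRiemannianTranslations := by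
  have hH : ∀ x ∈ X, ∀ y ∈ X, P.H x (y - x) = D.H x (y - x) :=
    fun x hx y hy => hP.H_eq hD.canonical hx hy
  refine ⟨hP.isCanonical, fun c hc s hs => ?_⟩
  rw [Deformation.vel_congr hH (hc.maps s hs), Deformation.vel_congr hH (hc.maps 0 (by simp))]
  exact hD.length c (hc.congr hH) s hs

/-- The rotations `π` transport the velocity of a canonical curve along itself. -/
lemma IsConsistent.π_vel (hP : P.IsConsistent D) {c : ℝ → E} (hc : P.IsCanonicalCurve c)
    (hΦ : ∀ s s' : ℝ, s ∈ Icc (0 : ℝ) 1 → s + s' ∈ Icc (0 : ℝ) 1 →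
      P.Φ (c 0) (s • P.vel c 0, 1) (s' • P.vel c s, 1) = ((s + s') • P.vel c 0, 1))
    {s : ℝ} (hs : s ∈ Icc (0 : ℝ) 1) :
    P.π (c 0) (s • P.vel c 0) (P.vel c s) = P.vel c 0 := by
  -- The rotational component of extended canonicity: the transport to c(u) is the transport to c(s)
  -- followed along the curve by the one from c(s) to c(u).
  have hmul : ∀ s ∈ Icc (0 : ℝ) 1, ∀ u ∈ Icc (0 : ℝ) 1, rotCLM (P.π (c 0) (u • P.vel c 0)) =
      (rotCLM (P.π (c 0) (s • P.vel c 0))).comp (rotCLM (P.π (c s) ((u - s) • P.vel c s))) := by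
    intro s hs u hu
    have h := hΦ s (u - s) hs (by simpa using hu)
    rw [add_sub_cancel] at h
    have h1 := congrArg Prod.fst h
    have h2 := congrArg Prod.snd h
    simp only [Φ] at h1 h2
    rw [h1, hc.point s hs, one_mul, mul_one, mul_inv_eq_one] at h2
    rw [← h2]
    rfl
  -- By `hmul` the derivative of u ↦ π_x(uτ) at u = s is π_x(sτ) ∘ γ(τ_{c(s)}), while the velocity
  -- has derivative −γ(τ_{c(s)})τ_{c(s)}. The two contributions cancel in the product rule.
  have hder : ∀ s ∈ Icc (0 : ℝ) 1, HasDerivWithinAt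
      (fun s => rotCLM (P.π (c 0) (s • P.vel c 0)) (P.vel c s)) 0 (Icc 0 1) s := by
    intro s hs
    have hX := hc.maps s hs
    have hg : HasFDerivAt (fun t => rotCLM (P.π (c s) t)) (P.gamma (c s))
        ((s - s) • P.vel c s) := by
      rw [sub_self, zero_smul, hP.lam_transport _ hX, ← hP.pi_transport _ hX]
      exact P.hasFDerivAt_π hX
    have hl : HasDerivWithinAt (fun u => (u - s) • P.vel c s) ((1 : ℝ) • P.vel c s)
        (Icc 0 1) s := ((hasDerivWithinAt_id s _).sub_const s).smul_const _
    rw [one_smul] at hl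
    have hM : HasDerivWithinAt (fun u => rotCLM (P.π (c 0) (u • P.vel c 0)))
        ((rotCLM (P.π (c 0) (s • P.vel c 0))).comp (P.gamma (c s) (P.vel c s))) (Icc 0 1) s := by
      have := (hasDerivWithinAt_const s (Icc (0 : ℝ) 1)
        (rotCLM (P.π (c 0) (s • P.vel c 0)))).clm_comp
        (hg.comp_hasDerivWithinAt s hl)
      refine (this.congr (fun u hu => hmul s hs u hu) (hmul s hs s hs)).congr_deriv ?_
      simp
    refine (hM.clm_apply (hc.hasDerivWithinAt_vel hs)).congr_deriv ?_
    simp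
  have hconst := constant_of_derivWithin_zero (fun s hs => (hder s hs).differentiableWithinAt)
    (fun s hs => (hder s ⟨hs.1, hs.2.le⟩).derivWithin
      (uniqueDiffOn_Icc one_pos s ⟨hs.1, hs.2.le⟩)) s hs
  have h0 : P.π (c 0) ((0 : ℝ) • P.vel c 0) = 1 := by
    rw [zero_smul, P.π_zero _ (hc.maps 0 (by simp))]
  rw [h0] at hconst
  exact hconst

lemma IsParallelTransports.exists_curve (hP : P.IsParallelTransports D) {x : E} (hx : x ∈ X)
    {t : T} (ht : t ∈ P.params x) :
    ∃ c, P.IsCanonicalCurve c ∧ c 0 = x ∧ P.vel c 0 = t ∧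
      ∀ s ∈ Icc (0 : ℝ) 1, P.π x (s • t) (P.vel c s) = t := by
  obtain ⟨c, hc, rfl, h1, hΦ⟩ := hP.canonical x hx _ (P.f_mem hx ht)
  obtain rfl := hc.vel_zero_eq ht h1
  exact ⟨c, hc, rfl, rfl, fun s hs => hP.consistent.π_vel hc hΦ hs⟩

/-- Both transports carry the final velocity of the canonical curve back to its initial velocity: π
by `π_vel`, `lam` by `lam_vel`. -/
lemma IsParallelTransports.lam_moveScale (hP : P.IsParallelTransports D) {x : E} (hx : x ∈ X)
    {τ : T} (hτ : τ ∈ P.params x) : P.lam x τ (P.moveScale (x, τ)).2 = τ := by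
  obtain ⟨c, hc, rfl, rfl, hπ⟩ := hP.exists_curve hx hτ
  have h1 := hπ 1 (by simp)
  rw [one_smul] at h1
  have h2 : (P.moveScale (c 0, P.vel c 0)).2 = P.vel c 1 :=
    (LinearIsometryEquiv.symm_apply_eq _).2 h1.symm
  rw [h2, hc.lam_vel]

lemma norm_moveScale (p : E × T) : ‖(P.moveScale p).2‖ = ‖p.2‖ :=
  LinearIsometryEquiv.norm_map _ _

lemma norm_moveScale_iterate (m : ℕ) (p : E × T) : ‖(P.moveScale^[m] p).2‖ = ‖p.2‖ := by
  induction m generalizing p with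
  | zero => rfl
  | succ m ih => rw [Function.iterate_succ_apply, ih, norm_moveScale]

/-- All the steps stay on one canonical curve, the one with initial velocity nτ. The base point and
the scale vary in the induction, and n drops by one with each step, since that many steps remain
available from the new point. -/
lemma IsParallelTransports.moveScale_iterate (hP : P.IsParallelTransports D) (m : ℕ) {n : ℕ}
    (hmn : m ≤ n) {x : E} (hx : x ∈ X) {τ : T} (hτ : (n : ℝ) • τ ∈ P.params x) :
    (P.moveScale^[m] (x, τ)).1 = P.f x ((m : ℝ) • τ) := by
  induction m generalizing n x τ with
  | zero => simp [P.f_zero hx]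
  | succ m ih =>
    obtain ⟨n, rfl⟩ : ∃ k, n = k + 1 := ⟨n - 1, by omega⟩
    set N : ℝ := ((n + 1 : ℕ) : ℝ) with hN
    have hNn : N = n + 1 := by rw [hN]; push_cast; rfl
    have hN0 : 0 < N := by positivity
    have hn0 : (0 : ℝ) ≤ n := by positivity
    obtain ⟨c, hc, rfl, hv, hπ⟩ := hP.exists_curve hx hτ
    have hs : N⁻¹ ∈ Icc (0 : ℝ) 1 := ⟨by positivity, inv_le_one_of_one_le₀ (by linarith)⟩
    have hτN : N⁻¹ • N • τ = τ := by rw [smul_smul, inv_mul_cancel₀ hN0.ne', one_smul]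
    have h1 := hπ _ hs
    rw [hτN] at h1
    -- One step is 1/N of the curve: the point becomes c(1/N), and the scale becomes 1/N of the
    -- velocity there because π transports velocity to velocity.
    have hmove : P.moveScale (c 0, τ) = (c N⁻¹, N⁻¹ • P.vel c N⁻¹) := by
      refine Prod.ext ?_ ((LinearIsometryEquiv.symm_apply_eq _).2 ?_)
      · have := hc.point _ hs
        rwa [hv, hτN] at this
      · rw [map_smul, h1, hτN]
    -- Seen from c(1/N), k further steps are the difference between the curve times (k + 1)/N and
    -- 1/N, the form in which the composition law applies.
    have hadd : ∀ k : ℝ, k * N⁻¹ = (k + 1) * N⁻¹ - N⁻¹ := fun k => by ring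
    have hle : ∀ k : ℕ, k ≤ n → ((k : ℝ) + 1) * N⁻¹ ∈ Icc (0 : ℝ) 1 := fun k hk => by
      refine ⟨by positivity, ?_⟩
      rw [← div_eq_mul_inv, div_le_one hN0, hNn]
      gcongr
    rw [Function.iterate_succ_apply, hmove, ih (n := n) (by omega) (hc.maps _ hs)]
    · rw [smul_smul, hadd, hc.f_vel hs (hle m (by omega)), ← hc.point _ (hle m (by omega)), hv,
        smul_smul, inv_mul_cancel_right₀ hN0.ne', Nat.cast_add, Nat.cast_one]
    · rw [smul_smul]
      refine hc.mem' _ _ hs ?_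
      rw [hadd, add_sub_cancel]
      exact hle n le_rfl

end GaugeDeformation

/-! ### Lengths of arbitrary curves as limits of chord sums. -/

/-- A sum of chords `‖F(tᵢ, tᵢ₊₁)‖`, where `F` vanishes on the diagonal, is a Riemann sum of the
norm of the derivative of `F` on the diagonal. -/
lemma exists_mesh_sum_norm {V : Type*} [NormedAddCommGroup V] [NormedSpace ℝ V] {a b : ℝ}
    (hab : a ≤ b) {F G : ℝ → ℝ → V} (hF0 : ∀ s ∈ Icc a b, F s s = 0)
    (hF : ∀ s ∈ Icc a b, ∀ u ∈ Icc a b, HasDerivWithinAt (F s) (G s u) (Icc a b) u)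
    (hG : ContinuousOn (Function.uncurry G) (Icc a b ×ˢ Icc a b)) {ε : ℝ} (hε : 0 < ε) :
    ∃ δ > 0, ∀ (n : ℕ) (t : ℕ → ℝ), Monotone t → t 0 = a → t n = b →
      (∀ i < n, t (i + 1) - t i < δ) →
      |∑ i ∈ Finset.range n, ‖F (t i) (t (i + 1))‖ - ∫ s in a..b, ‖G s s‖| < ε := by
  -- Each chord will have error at most 2η times its parameter length, in total 2η(b − a) < ε; the
  -- added 1 keeps η defined when a = b.
  have hpos : 0 < 2 * (b - a + 1) := by linarith
  set η := ε / (2 * (b - a + 1)) with hη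
  have hη0 : 0 < η := div_pos hε hpos
  obtain ⟨δ, hδ, hunif⟩ := Metric.uniformContinuousOn_iff.1
    ((isCompact_Icc.prod isCompact_Icc).uniformContinuousOn_of_continuous hG) η hη0
  have hdiag : ContinuousOn (fun s => ‖G s s‖) (Icc a b) :=
    (hG.comp (f := fun s : ℝ => (s, s)) (by fun_prop) fun s hs => ⟨hs, hs⟩).norm
  have hlocal : ∀ s ∈ Icc a b, ∀ u ∈ Icc a b, s ≤ u → u - s < δ →
      |‖F s u‖ - ∫ v in s..u, ‖G v v‖| ≤ 2 * η * (u - s) := by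
    intro s hs u hu hsu hδu
    have hsub : Icc s u ⊆ Icc a b := Icc_subset_Icc hs.1 hu.2
    -- Used twice: with first argument s, to compare F(s, u) with (u − s)G(s, s) by the mean value
    -- inequality, and on the diagonal, to compare the integral of ‖G(v, v)‖ with (u − s)‖G(s, s)‖.
    have hclose : ∀ v ∈ Icc s u, ∀ w ∈ Icc s u, ‖G w v - G s s‖ ≤ η := by
      intro v hv w hw
      rw [← dist_eq_norm]
      refine (hunif (w, v) ⟨hsub hw, hsub hv⟩ (s, s) ⟨hs, hs⟩ ?_).le
      rw [Prod.dist_eq, max_lt_iff, Real.dist_eq, Real.dist_eq, abs_of_nonneg (by linarith [hw.1]),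
        abs_of_nonneg (by linarith [hv.1])]
      exact ⟨by linarith [hw.2], by linarith [hv.2]⟩
    have h1 : ‖F s u - (u - s) • G s s‖ ≤ η * (u - s) := by
      have := Convex.norm_image_sub_le_of_norm_hasDerivWithin_le (s := Icc s u) (C := η)
        (f := fun v => F s v - (v - s) • G s s) (f' := fun v => G s v - (1 : ℝ) • G s s)
        (fun v hv => ((hF s hs v (hsub hv)).mono hsub).sub
          (((hasDerivWithinAt_id v _).sub_const s).smul_const _))
        (fun v hv => by
          rw [one_smul]
          exact hclose v hv s (left_mem_Icc.2 hsu)) (convex_Icc s u)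
        (left_mem_Icc.2 hsu) (right_mem_Icc.2 hsu)
      simpa [hF0 s hs, abs_of_nonneg (sub_nonneg.2 hsu)] using this
    have hint : IntervalIntegrable (fun v => ‖G v v‖) MeasureTheory.volume s u :=
      (hdiag.mono (by rwa [uIcc_of_le hsu])).intervalIntegrable
    have h2 : |(∫ v in s..u, ‖G v v‖) - (u - s) * ‖G s s‖| ≤ η * (u - s) := by
      have e : (∫ v in s..u, ‖G v v‖) - (u - s) * ‖G s s‖ =
          ∫ v in s..u, (‖G v v‖ - ‖G s s‖) := by
        rw [intervalIntegral.integral_sub hint (by simp), intervalIntegral.integral_const,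
          smul_eq_mul]
      rw [e, ← Real.norm_eq_abs]
      refine (intervalIntegral.norm_integral_le_of_norm_le_const (C := η) fun v hv => ?_).trans
        (by rw [abs_of_nonneg (sub_nonneg.2 hsu)])
      rw [uIoc_of_le hsu] at hv
      exact (abs_norm_sub_norm_le _ _).trans (hclose v ⟨hv.1.le, hv.2⟩ v ⟨hv.1.le, hv.2⟩)
    have h3 : |‖F s u‖ - (u - s) * ‖G s s‖| ≤ η * (u - s) := by
      have : (u - s) * ‖G s s‖ = ‖(u - s) • G s s‖ := by
        rw [norm_smul, Real.norm_of_nonneg (sub_nonneg.2 hsu)]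
      rw [this]
      exact (abs_norm_sub_norm_le _ _).trans h1
    calc |‖F s u‖ - ∫ v in s..u, ‖G v v‖|
        = |(‖F s u‖ - (u - s) * ‖G s s‖) - ((∫ v in s..u, ‖G v v‖) - (u - s) * ‖G s s‖)| := by
          congr 1; ring
      _ ≤ η * (u - s) + η * (u - s) := (abs_sub _ _).trans (add_le_add h3 h2)
      _ = 2 * η * (u - s) := by ring
  refine ⟨δ, hδ, fun n t ht h0 hn hmesh => ?_⟩
  have hmem : ∀ i ≤ n, t i ∈ Icc a b := fun i hi => ⟨h0 ▸ ht (Nat.zero_le i), hn ▸ ht hi⟩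
  have hsum : ∑ i ∈ Finset.range n, ∫ v in t i..t (i + 1), ‖G v v‖ = ∫ v in a..b, ‖G v v‖ := by
    rw [intervalIntegral.sum_integral_adjacent_intervals, h0, hn]
    intro i hi
    refine (hdiag.mono ?_).intervalIntegrable
    rw [uIcc_of_le (ht (Nat.le_succ i))]
    exact Icc_subset_Icc (hmem i hi.le).1 (hmem (i + 1) hi).2
  rw [← hsum, ← Finset.sum_sub_distrib]
  calc |∑ i ∈ Finset.range n, (‖F (t i) (t (i + 1))‖ - ∫ v in t i..t (i + 1), ‖G v v‖)|
      ≤ ∑ i ∈ Finset.range n, |‖F (t i) (t (i + 1))‖ - ∫ v in t i..t (i + 1), ‖G v v‖| :=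
        Finset.abs_sum_le_sum_abs _ _
    _ ≤ ∑ i ∈ Finset.range n, 2 * η * (t (i + 1) - t i) := by
        refine Finset.sum_le_sum fun i hi => ?_
        have hi := Finset.mem_range.1 hi
        exact hlocal _ (hmem i hi.le) _ (hmem (i + 1) hi) (ht (Nat.le_succ i)) (hmesh i hi)
    _ = 2 * η * (b - a) := by rw [← Finset.mul_sum, Finset.sum_range_sub, h0, hn]
    _ < ε := by
        have : η * (2 * (b - a + 1)) = ε := div_mul_cancel₀ _ hpos.ne'
        nlinarith

lemma Deformation.exists_mesh_curveLength (D : Deformation X T) {a b : ℝ} {c : ℝ → E}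
    (hab : a ≤ b) (hc : ContDiffOn ℝ 1 c (Icc a b)) (hX : ∀ s ∈ Icc a b, c s ∈ X) {ε : ℝ}
    (hε : 0 < ε) :
    ∃ δ > 0, ∀ (n : ℕ) (t : ℕ → ℝ), Monotone t → t 0 = a → t n = b →
      (∀ i < n, t (i + 1) - t i < δ) →
      |∑ i ∈ Finset.range n, ‖D.H (c (t i)) (c (t (i + 1)) - c (t i))‖ -
        curveLength D.metric a b c| < ε := by
  have hcd : ContinuousOn (derivWithin c (Icc a b)) (Icc a b) := by
    rcases hab.eq_or_lt with rfl | hab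
    · rw [Icc_self]
      exact continuousOn_singleton _ _
    · exact hc.continuousOn_derivWithin (uniqueDiffOn_Icc hab) le_rfl
  have hm : ∀ s ∈ Icc a b, ∀ u ∈ Icc a b, c s + (c u - c s) ∈ X := fun s _ u hu => by
    simpa using hX u hu
  have hlen : curveLength D.metric a b c =
      ∫ s in a..b, ‖fderiv ℝ (D.H (c s)) (c s - c s) (derivWithin c (Icc a b) s)‖ := by
    refine intervalIntegral.integral_congr fun s _ => ?_
    rw [sub_self]
    exact D.vecLength_metric _ _
  rw [hlen]
  -- The chord is F(s, u) = H_{c(s)}(c(u) − c(s)). On the diagonal its u-derivative is h c', whose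
  -- norm is the Riemannian speed.
  refine exists_mesh_sum_norm hab (F := fun s u => D.H (c s) (c u - c s))
    (G := fun s u => fderiv ℝ (D.H (c s)) (c u - c s) (derivWithin c (Icc a b) u))
    (fun s hs => by rw [sub_self]; exact D.map_zero _ (hX s hs)) (fun s hs u hu => ?_) ?_ hε
  · exact (D.hasFDerivAt_H (hX s hs) (hm s hs u hu)).comp_hasDerivWithinAt u
      (((hc u hu).differentiableWithinAt (by simp)).hasDerivWithinAt.sub_const _)
  · have h1 : ContinuousOn (fun p : ℝ × ℝ => c p.1) (Icc a b ×ˢ Icc a b) :=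
      hc.continuousOn.comp continuousOn_fst fun p hp => hp.1
    have h2 : ContinuousOn (fun p : ℝ × ℝ => c p.2) (Icc a b ×ˢ Icc a b) :=
      hc.continuousOn.comp continuousOn_snd fun p hp => hp.2
    have h3 : ContinuousOn (fun p : ℝ × ℝ => derivWithin c (Icc a b) p.2) (Icc a b ×ˢ Icc a b) :=
      hcd.comp continuousOn_snd fun p hp => hp.2
    refine ContinuousOn.clm_apply (fun p hp => ?_) h3
    exact (D.contDiffAt_uncurry_fderiv (hX _ hp.1)
      (hm _ hp.1 _ hp.2)).continuousAt.comp_continuousWithinAt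
      (f := fun p : ℝ × ℝ => (c p.1, c p.2 - c p.1)) ((h1 p hp).prodMk ((h2 p hp).sub (h1 p hp)))

end GaugeGeometry

theorem theorem4
    {E : Type*} [NormedAddCommGroup E] [NormedSpace ℝ E] [FiniteDimensional ℝ E]
    {T : Type*} [NormedAddCommGroup T] [InnerProductSpace ℝ T] [FiniteDimensional ℝ T]
    (X : Opens E)
    -- the group of Riemannian translations `RT = DefTrans D`
    (D : Deformation X T) (hD : D.IsRiemannianTranslations)
    -- the group of parallel transports `DP = DefGauge P`
    (P : GaugeDeformation X T) (hP : P.IsParallelTransports D) :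
    -- (1) `DP` acts on `X` as `RT` does
    (∀ x ∈ X, P.params x = D.params x ∧ (∀ t ∈ P.params x, P.f x t = D.f x t) ∧
      ∀ t ∈ P.params x, ∀ t' ∈ P.params (P.f x t), P.φ x t t' = D.φ x t t') ∧
    (∃ proj : DefGauge P →* DefTrans D, Function.Surjective proj ∧
      ∀ ϑ, proj ϑ⁻¹ = (proj ϑ)⁻¹ ∧ (proj ϑ).dom = ϑ.dom ∧ (proj ϑ).par = ϑ.par ∧
        ∀ x ∈ ϑ.dom, (proj ϑ).act x = ϑ.act x) ∧
    -- the inefficiency kernel is `R^g`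
    (∃ incl : Gauge.Rotations X T →* DefGauge P, Function.Injective incl ∧
      (∀ ρ, (incl ρ).dom = ρ.1.dom ∧ (∀ x, (incl ρ).par x = 0) ∧ (incl ρ).rot = ρ.1.rot) ∧
      ∀ ϑ, ϑ ∈ Set.range incl ↔ ∀ x ∈ ϑ.dom, ϑ.act x = x) ∧
    -- (2) the Riemannian structure: metric, orthonormal frame, Levi-Civita connection
    IsRiemannianMetric X P.metric ∧
    (∀ x ∈ X, P.metric x = D.metric x ∧
      ∀ τ τ' : T, P.metric x (P.k x τ) (P.k x τ') = inner ℝ τ τ') ∧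
    IsLeviCivita X P.metric P.Gam ∧
    -- (3) the length principle: translations move points along geodesics, the parameter
    -- measuring their length; a scale moved along itself remains a scale of the same length
    -- and subdivides the geodesic; the lengths of all curves are obtained in this way
    (∀ x ∈ X, ∀ x' ∈ X, ∃ τ ∈ P.params x, P.f x τ = x') ∧
    (∀ x ∈ X, ∀ (τ : T) (S : ℝ), 0 ≤ S → S • τ ∈ P.params x →
      (∀ s ∈ Set.Icc 0 S, s • τ ∈ P.params x) ∧
      (0 < S → IsGeodesic X P.Gam 0 S (fun s => P.f x (s • τ))) ∧
      curveLength P.metric 0 S (fun s => P.f x (s • τ)) = S * ‖τ‖) ∧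
    (∀ x ∈ X, ∀ (τ : T) (n : ℕ), (n : ℝ) • τ ∈ P.params x → ∀ m ≤ n,
      (P.moveScale^[m] (x, τ)).1 = P.f x ((m : ℝ) • τ) ∧
      ‖(P.moveScale^[m] (x, τ)).2‖ = ‖τ‖ ∧
      curveLength P.metric 0 m (fun s => P.f x (s • τ)) = m * ‖τ‖) ∧
    (∀ x ∈ X, ∀ τ ∈ P.params x, D.lam x τ (P.moveScale (x, τ)).2 = τ) ∧
    (∀ (a b : ℝ) (c : ℝ → E), a ≤ b → ContDiffOn ℝ 1 c (Set.Icc a b) →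
      (∀ s ∈ Set.Icc a b, c s ∈ X) → ∀ ε > 0, ∃ δ > 0, ∀ (n : ℕ) (t : ℕ → ℝ),
        Monotone t → t 0 = a → t n = b → (∀ i < n, t (i + 1) - t i < δ) →
        |∑ i ∈ Finset.range n, ‖P.H (c (t i)) (c (t (i + 1)) - c (t i))‖ -
          curveLength P.metric a b c| < ε) ∧
    -- (4) the equality principle: `DP` acts in `TX`, preserves lengths and angles, and
    -- congruent figures (families of tangent vectors at a point) are those that can be superimposed
    ((∀ x ∈ X, ∀ v, (1 : DefGauge P).act x = x ∧ (1 : DefGauge P).tangentAct x v = v) ∧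
      ∀ (ϑ ϑ' : DefGauge P), ∀ x ∈ (ϑ * ϑ').dom, ∀ v,
        (ϑ * ϑ').act x = ϑ'.act (ϑ.act x) ∧
        (ϑ * ϑ').tangentAct x v = ϑ.tangentAct x (ϑ'.tangentAct (ϑ.act x) v)) ∧
    (∀ (ϑ : DefGauge P), ∀ x ∈ ϑ.dom, ∀ v w,
      vecLength P.metric x (ϑ.tangentAct x v) = vecLength P.metric (ϑ.act x) v ∧
      vecAngle P.metric x (ϑ.tangentAct x v) (ϑ.tangentAct x w) =
        vecAngle P.metric (ϑ.act x) v w) ∧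
    (∀ x ∈ X, ∀ x' ∈ X, ∀ (ι : Type) (v w : ι → E),
      (∃ ϑ : DefGauge P, x ∈ ϑ.dom ∧ ϑ.act x = x' ∧ ∀ i, ϑ.tangentAct x (v i) = w i) ↔
        ∀ i j, P.metric x' (v i) (v j) = P.metric x (w i) (w j)) ∧
    -- (5) `DP` contains `RT` as a subgroup
    (∃ emb : DefTrans D →* DefGauge P, Function.Injective emb ∧
      ∀ a, emb a⁻¹ = (emb a)⁻¹ ∧ (emb a).dom = a.dom ∧ (emb a).par = a.par ∧
        (∀ x ∈ a.dom, (emb a).L x = 1) ∧ ∀ x ∈ a.dom, (emb a).act x = a.act x) := by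
  -- Rigidity: this coincidence gives part 1, the equality of the metrics, the comparison with the
  -- transport of `RT`, and the equality of parameters in part 5.
  have hH : ∀ x ∈ X, ∀ y ∈ X, P.H x (y - x) = D.H x (y - x) :=
    fun x hx y hy => hP.H_eq hD.canonical hx hy
  have hR := hP.isRiemannianTranslations hD
  refine ⟨fun x hx => ⟨Deformation.params_congr hH hx,
      fun t ht => Deformation.f_congr hH hx ht,
      fun t ht t' ht' => Deformation.φ_congr hH hx ht ht'⟩,
    ⟨DefGauge.proj P D, DefGauge.proj_surjective P, fun ϑ => ⟨DefGauge.proj_inv P ϑ,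
      DefGauge.proj_dom P ϑ, DefGauge.proj_par P hH ϑ, fun x hx => DefGauge.proj_act P ϑ hx⟩⟩,
    ⟨DefGauge.incl P, DefGauge.incl_injective P, fun ρ => ⟨rfl, DefGauge.incl_par P ρ,
      DefGauge.incl_rot P ρ⟩, DefGauge.mem_range_incl P⟩,
    P.isRiemannianMetric, fun x hx => ⟨?_, P.metric_k hx⟩,
    P.isLeviCivita fun x hx => hP.consistent.gamma_skew hx,
    fun x hx x' hx' => ⟨_, P.H_sub_mem_params hx', P.f_H_sub hx hx'⟩,
    fun x hx τ S hS hm => ⟨fun s hs => hP.isCanonical.smul_mem_params hx hm hs,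
      fun hS' => hP.isCanonical.isGeodesic_f hx hS' hm, hR.curveLength_f hx hS hm⟩,
    fun x hx τ n hm m hmn => ⟨hP.moveScale_iterate m hmn hx hm,
      P.norm_moveScale_iterate m (x, τ), hR.curveLength_f hx m.cast_nonneg
        (hP.isCanonical.smul_mem_params hx hm ⟨m.cast_nonneg, Nat.cast_le.2 hmn⟩)⟩,
    fun x hx τ hτ => ?_,
    fun a b c hab hc hX ε hε => P.exists_mesh_curveLength hab hc hX hε,
    ⟨fun x hx v => ⟨DefGauge.one_act hx, DefGauge.one_tangentAct hx v⟩,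
      fun ϑ ϑ' x hx v => ⟨ϑ.mul_act ϑ' hx, ϑ.mul_tangentAct ϑ' hx v⟩⟩,
    fun ϑ x hx v w => ⟨ϑ.vecLength_tangentAct hx v, ϑ.vecAngle_tangentAct hx v w⟩,
    fun x hx x' hx' ι v w => DefGauge.exists_tangentAct_iff hx hx' v w,
    ⟨DefGauge.emb P D, DefGauge.emb_injective P, fun a => ⟨DefGauge.emb_inv P a,
      DefGauge.emb_dom P a, DefGauge.emb_par P hH a, fun x hx => DefGauge.emb_L P a hx,
      fun x hx => DefGauge.emb_act P a hx⟩⟩⟩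
  · ext v w
    rw [Deformation.metric, Deformation.metric, Deformation.h_congr hH hx]
  · rw [← Deformation.lam_congr hH hx hτ, hP.lam_moveScale hx hτ]
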